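/- Let $c>0$. Let $T=(1-x^2)\frac{d^2}{dx^2}-2x\frac{d}{dx}-c^2x^2$ act on the space $C^\infty[-1,1]$ of functions smooth up to the boundary, let $\mathcal{R}f(x)=f(-x)$ be the reflection operator on the complex Hilbert space $L^2[-1,1]$, and let $\mathcal{Q}_c$ be the integral operator on $L^2[-1,1]$ given by $$\mathcal{Q}_c[\phi](x)=\int_{-1}^{1}\frac{\sin(c(x-t))}{\pi(x-t)}\,\phi(t)\,dt .$$ Define polynomials $U_k$ by $U_0=1$ and $$U_{k+1}(T)=\frac{T+c^2+k(k+1)}{2(k+1)}\,U_k(T)-\frac{c^2k}{k+1}\,U_{k-1}(T)+\frac{c^2k(k-1)}{2(k+1)}\,U_{k-2}(T)\qquad(k\ge 0),$$ where terms with a negative index are absent since their coefficients vanish. Let $$U(\xi;T)=\sum_{k=0}^{\infty}\frac{\xi^k\,U_k(T)}{k!},$$ meaning the closure in $L^2[-1,1]$ of the operator that sends $f$ to the $L^2$-sum of $\sum_k \xi^k U_k(T)f/k!$ and whose domain consists of all $f\in C^\infty[-1,1]$ for which this series converges in $L^2[-1,1]$. Then for every $\xi\in[0,1]$ the operator defined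 by the series is densely defined and closable, its closure $U(\xi;T)$ is a bounded operator defined on all of $L^2[-1,1]$, and $$\mathcal{Q}_c=\int_0^1\left(\frac{\sin(c\xi)}{\pi\xi}+\frac{\sin(c(2-\xi))}{\pi(2-\xi)}\,\mathcal{R}\right)U(\xi;T)\,d\xi$$ as operators on $L^2[-1,1]$: for every $f\in L^2[-1,1]$ the function $\xi\mapsto\left(\frac{\sin(c\xi)}{\pi\xi}+\frac{\sin(c(2-\xi))}{\pi(2-\xi)}\mathcal{R}\right)U(\xi;T)f$ is Bochner integrable on $[0,1]$ with values in $L^2[-1,1]$, and its integral is $\mathcal{Q}_cf$. -/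

import Mathlib

open MeasureTheory Set Filter Topology
open scoped ContDiff

noncomputable section

/-- Lebesgue measure on the interval `[-1,1]`. -/
abbrev muI : Measure ℝ := volume.restrict (Icc (-1 : ℝ) 1)

/-- The complex Hilbert space `L²[-1,1]`. -/
abbrev L2I : Type := Lp ℂ 2 muI

/-- The differential expression `(1 - x²) g'' - 2 x g' - c² x² g`. -/
def heunExpr (c : ℝ) (g : ℝ → ℂ) (x : ℝ) : ℂ :=
  (1 - (x : ℂ) ^ 2) * deriv (deriv g) x - 2 * (x : ℂ) * deriv g x
    - (c : ℂ) ^ 2 * (x : ℂ) ^ 2 * g x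

theorem contDiff_deriv_of_smooth {g : ℝ → ℂ} (hg : ContDiff ℝ ∞ g) :
    ContDiff ℝ ∞ (deriv g) :=
  (contDiff_infty_iff_deriv.1 hg).2

theorem contDiff_heunExpr (c : ℝ) {g : ℝ → ℂ} (hg : ContDiff ℝ ∞ g) :
    ContDiff ℝ ∞ (heunExpr c g) := by
  have h1 := contDiff_deriv_of_smooth hg
  have h2 := contDiff_deriv_of_smooth h1
  have hx : ContDiff ℝ ∞ (fun x : ℝ => (x : ℂ)) := Complex.ofRealCLM.contDiff
  unfold heunExpr
  fun_prop

theorem memLp_of_continuous_muI {g : ℝ → ℂ} (hg : Continuous g) : MemLp g 2 muI := by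
  obtain ⟨C, hC⟩ := (isCompact_Icc (a := (-1 : ℝ)) (b := 1)).exists_bound_of_continuousOn
    hg.continuousOn
  refine MemLp.of_bound hg.aestronglyMeasurable C ?_
  exact (ae_restrict_iff' measurableSet_Icc).2 (Eventually.of_forall hC)

theorem heunExpr_congr (c : ℝ) {g h : ℝ → ℂ} (hg : ContDiff ℝ ∞ g) (hh : ContDiff ℝ ∞ h)
    (hgh : g =ᵐ[muI] h) : heunExpr c g =ᵐ[muI] heunExpr c h := by
  have h0 : g =ᵐ[volume.restrict (Ioo (-1 : ℝ) 1)] h :=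
    ae_restrict_of_ae_restrict_of_subset Ioo_subset_Icc_self hgh
  have h1 : EqOn g h (Ioo (-1 : ℝ) 1) :=
    Measure.eqOn_open_of_ae_eq h0 isOpen_Ioo hg.continuous.continuousOn
      hh.continuous.continuousOn
  have h2 : EqOn (heunExpr c g) (heunExpr c h) (Ioo (-1 : ℝ) 1) := by
    intro x hx
    have e0 : g =ᶠ[𝓝 x] h := h1.eventuallyEq_of_mem (isOpen_Ioo.mem_nhds hx)
    have e1 := e0.deriv
    have e2 := e1.deriv
    simp only [heunExpr, e0.eq_of_nhds, e1.eq_of_nhds, e2.eq_of_nhds]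
  have h3 : muI = volume.restrict (Ioo (-1 : ℝ) 1) :=
    (Measure.restrict_congr_set Ioo_ae_eq_Icc).symm
  rw [h3]
  exact (ae_restrict_iff' measurableSet_Ioo).2 (Eventually.of_forall h2)

/-- The dense subspace `C^∞[-1,1]` of `L²[-1,1]`: the classes of functions that are smooth up to
the boundary, i.e. that agree on `[-1,1]` with a smooth function on the line. -/
def smoothI : Submodule ℂ L2I where
  carrier := {f | ∃ g : ℝ → ℂ, ContDiff ℝ ∞ g ∧ f =ᵐ[muI] g}
  zero_mem' := ⟨0, contDiff_zero_fun, Lp.coeFn_zero _ _ _⟩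
  add_mem' := by
    rintro a b ⟨g, hg, hag⟩ ⟨h, hh, hbh⟩
    exact ⟨g + h, hg.add hh, (Lp.coeFn_add a b).trans (hag.add hbh)⟩
  smul_mem' := by
    rintro z a ⟨g, hg, hag⟩
    exact ⟨z • g, hg.const_smul z, (Lp.coeFn_smul z a).trans (hag.const_smul z)⟩

/-- A smooth representative of an element of `C^∞[-1,1]`. -/
def smoothRep (f : smoothI) : ℝ → ℂ := f.2.choose

theorem smoothRep_contDiff (f : smoothI) : ContDiff ℝ ∞ (smoothRep f) := f.2.choose_spec.1

theorem smoothRep_ae (f : smoothI) : (f : L2I) =ᵐ[muI] smoothRep f := f.2.choose_spec.2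

/-- The underlying function of the Heun operator `T`. -/
def heunFun (c : ℝ) (f : smoothI) : smoothI :=
  ⟨(memLp_of_continuous_muI (contDiff_heunExpr c (smoothRep_contDiff f)).continuous).toLp _,
    heunExpr c (smoothRep f), contDiff_heunExpr c (smoothRep_contDiff f), MemLp.coeFn_toLp _⟩

/-- `T f` is computed with any smooth representative of `f`. -/
theorem heunFun_ae (c : ℝ) (f : smoothI) {g : ℝ → ℂ} (hg : ContDiff ℝ ∞ g)
    (hfg : (f : L2I) =ᵐ[muI] g) : (heunFun c f : L2I) =ᵐ[muI] heunExpr c g :=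
  (MemLp.coeFn_toLp (memLp_of_continuous_muI
    (contDiff_heunExpr c (smoothRep_contDiff f)).continuous)).trans
    (heunExpr_congr c (smoothRep_contDiff f) hg ((smoothRep_ae f).symm.trans hfg))

theorem heunExpr_add (c : ℝ) {g h : ℝ → ℂ} (hg : ContDiff ℝ ∞ g) (hh : ContDiff ℝ ∞ h) :
    heunExpr c (g + h) = heunExpr c g + heunExpr c h := by
  have n0 : (∞ : WithTop ℕ∞) ≠ 0 := by simp
  have d1 : deriv (g + h) = deriv g + deriv h := by
    funext x
    exact deriv_add (hg.differentiable n0 x) (hh.differentiable n0 x)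
  have d2 : deriv (deriv g + deriv h) = deriv (deriv g) + deriv (deriv h) := by
    funext x
    exact deriv_add ((contDiff_deriv_of_smooth hg).differentiable n0 x)
      ((contDiff_deriv_of_smooth hh).differentiable n0 x)
  funext x
  simp only [heunExpr, d1, d2, Pi.add_apply]
  ring

theorem heunExpr_smul (c : ℝ) (z : ℂ) {g : ℝ → ℂ} (hg : ContDiff ℝ ∞ g) :
    heunExpr c (z • g) = z • heunExpr c g := by
  have n0 : (∞ : WithTop ℕ∞) ≠ 0 := by simp
  have d1 : deriv (z • g) = z • deriv g := by
    funext x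
    exact deriv_const_smul z (hg.differentiable n0 x)
  have d2 : deriv (z • deriv g) = z • deriv (deriv g) := by
    funext x
    exact deriv_const_smul z ((contDiff_deriv_of_smooth hg).differentiable n0 x)
  funext x
  simp only [heunExpr, d1, d2, Pi.smul_apply, smul_eq_mul]
  ring

/-- The Heun operator `T = (1 - x²) d²/dx² - 2 x d/dx - c² x²` on `C^∞[-1,1]`. -/
def heunT (c : ℝ) : Module.End ℂ smoothI where
  toFun := heunFun c
  map_add' f g := by
    have hf := smoothRep_contDiff f
    have hg := smoothRep_contDiff g
    apply Subtype.ext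
    apply Lp.ext
    refine (heunFun_ae c (f + g) (hf.add hg)
      ((Lp.coeFn_add _ _).trans ((smoothRep_ae f).add (smoothRep_ae g)))).trans ?_
    rw [show (fun x => smoothRep f x + smoothRep g x) = smoothRep f + smoothRep g from rfl,
      heunExpr_add c hf hg]
    exact (((heunFun_ae c f hf (smoothRep_ae f)).add
      (heunFun_ae c g hg (smoothRep_ae g))).symm).trans (Lp.coeFn_add _ _).symm
  map_smul' z f := by
    have hf := smoothRep_contDiff f
    apply Subtype.ext
    apply Lp.ext
    refine (heunFun_ae c (z • f) (hf.const_smul z)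
      ((Lp.coeFn_smul _ _).trans ((smoothRep_ae f).const_smul z))).trans ?_
    have e := heunExpr_smul c z hf
    rw [show (fun x => z • smoothRep f x) = z • smoothRep f from rfl, e]
    exact ((heunFun_ae c f hf (smoothRep_ae f)).const_smul z).symm.trans
      (Lp.coeFn_smul _ _).symm

open Polynomial in
/-- The polynomials `U_k`, for the bandwidth parameter `c`. -/
def heunPoly (c : ℝ) : ℕ → ℂ[X]
  | 0 => 1
  | 1 => C (1 / 2 : ℂ) * (X + C ((c : ℂ) ^ 2))
  | 2 => C (1 / 4 : ℂ) * (X + C ((c : ℂ) ^ 2 + 2)) * heunPoly c 1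
      - C ((c : ℂ) ^ 2 / 2) * heunPoly c 0
  | k + 3 =>
      C (1 / (2 * ((k : ℂ) + 3))) * (X + C ((c : ℂ) ^ 2 + ((k : ℂ) + 2) * ((k : ℂ) + 3)))
          * heunPoly c (k + 2)
        - C ((c : ℂ) ^ 2 * ((k : ℂ) + 2) / ((k : ℂ) + 3)) * heunPoly c (k + 1)
        + C ((c : ℂ) ^ 2 * ((k : ℂ) + 2) * ((k : ℂ) + 1) / (2 * ((k : ℂ) + 3))) * heunPoly c k

open Polynomial in
/-- The four-term recurrence for all `k`; terms of negative index carry the coefficient `0`. -/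
theorem heunPoly_succ (c : ℝ) (k : ℕ) :
    heunPoly c (k + 1) =
      C (1 / (2 * ((k : ℂ) + 1))) * (X + C ((c : ℂ) ^ 2 + (k : ℂ) * ((k : ℂ) + 1)))
          * heunPoly c k
        - C ((c : ℂ) ^ 2 * (k : ℂ) / ((k : ℂ) + 1)) * heunPoly c (k - 1)
        + C ((c : ℂ) ^ 2 * (k : ℂ) * ((k : ℂ) - 1) / (2 * ((k : ℂ) + 1)))
          * heunPoly c (k - 2) := by
  match k with
  | 0 => simp [heunPoly]
  | 1 =>
    simp only [heunPoly, Nat.sub_self]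
    norm_num [heunPoly]
  | k + 2 =>
    simp only [heunPoly, Nat.add_sub_cancel]
    rw [show k + 2 - 1 = k + 1 from rfl]
    push_cast
    rw [show (k : ℂ) + 2 + 1 = k + 3 by ring, show (k : ℂ) + 2 - 1 = k + 1 by ring]

/-- The `n`-th partial sum `∑_{k < n} ξ^k U_k(T) / k!`, a polynomial in `T` on `C^∞[-1,1]`. -/
def heunPartialSum (c ξ : ℝ) (n : ℕ) : Module.End ℂ smoothI :=
  ∑ k ∈ Finset.range n,
    ((ξ : ℂ) ^ k / (k.factorial : ℂ)) • Polynomial.aeval (heunT c) (heunPoly c k)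

/-- The subspace of all `f` in `C^∞[-1,1]` for which `∑ ξ^k U_k(T) f / k!` converges in
`L²[-1,1]`. -/
def heunSeriesDomain (c ξ : ℝ) : Submodule ℂ smoothI where
  carrier := {f | ∃ h : L2I,
    Tendsto (fun n => ((heunPartialSum c ξ n f : smoothI) : L2I)) atTop (𝓝 h)}
  zero_mem' := ⟨0, by simp⟩
  add_mem' := by
    rintro a b ⟨g, hg⟩ ⟨h, hh⟩
    exact ⟨g + h, by simpa using hg.add hh⟩
  smul_mem' := by
    rintro z a ⟨g, hg⟩
    exact ⟨z • g, by simpa using hg.const_smul z⟩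

theorem heunSeriesDomain_of_mem_map {c ξ : ℝ} {f : L2I}
    (hf : f ∈ (heunSeriesDomain c ξ).map smoothI.subtype) :
    ∃ hs : f ∈ smoothI, ∃ h : L2I,
      Tendsto (fun n => ((heunPartialSum c ξ n ⟨f, hs⟩ : smoothI) : L2I)) atTop (𝓝 h) := by
  obtain ⟨g, hg, rfl⟩ := hf
  exact ⟨g.2, hg⟩

/-- The sum of the series `∑ ξ^k U_k(T) f / k!` for `f` in its domain of convergence. -/
def heunSeriesValue (c ξ : ℝ) (f : (heunSeriesDomain c ξ).map smoothI.subtype) : L2I :=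
  (heunSeriesDomain_of_mem_map f.2).choose_spec.choose

theorem heunSeriesValue_spec (c ξ : ℝ) (f : (heunSeriesDomain c ξ).map smoothI.subtype)
    (hs : (f : L2I) ∈ smoothI) :
    Tendsto (fun n => ((heunPartialSum c ξ n ⟨f, hs⟩ : smoothI) : L2I)) atTop
      (𝓝 (heunSeriesValue c ξ f)) :=
  (heunSeriesDomain_of_mem_map f.2).choose_spec.choose_spec

/-- The partially defined operator `f ↦ ∑_{k ≥ 0} ξ^k U_k(T) f / k!` in `L²[-1,1]`,
whose domain consists of all `f` in `C^∞[-1,1]` for which the series converges in `L²[-1,1]`. -/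
def heunSeries (c ξ : ℝ) : L2I →ₗ.[ℂ] L2I where
  domain := (heunSeriesDomain c ξ).map smoothI.subtype
  toFun :=
    { toFun := heunSeriesValue c ξ
      map_add' := by
        intro f g
        have hf := (heunSeriesDomain_of_mem_map f.2).choose
        have hg := (heunSeriesDomain_of_mem_map g.2).choose
        refine tendsto_nhds_unique
          (heunSeriesValue_spec c ξ (f + g) (smoothI.add_mem hf hg)) ?_
        have := (heunSeriesValue_spec c ξ f hf).add (heunSeriesValue_spec c ξ g hg)
        refine this.congr (fun n => ?_)
        rw [← Submodule.coe_add, ← map_add]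
        rfl
      map_smul' := by
        intro z f
        have hf := (heunSeriesDomain_of_mem_map f.2).choose
        refine tendsto_nhds_unique
          (heunSeriesValue_spec c ξ (z • f) (smoothI.smul_mem z hf)) ?_
        have := (heunSeriesValue_spec c ξ f hf).const_smul z
        refine this.congr (fun n => ?_)
        rw [← Submodule.coe_smul, ← map_smul]
        rfl }

/-- The operator `U(ξ; T)` in `L²[-1,1]`: the closure of `∑_{k ≥ 0} ξ^k U_k(T) / k!`. -/
def heunU (c ξ : ℝ) : L2I →ₗ.[ℂ] L2I := (heunSeries c ξ).closure

theorem measurePreserving_neg_muI : MeasurePreserving (fun x : ℝ => -x) muI muI := by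
  have h := (Measure.measurePreserving_neg (volume : Measure ℝ)).restrict_preimage
    (measurableSet_Icc (a := (-1 : ℝ)) (b := 1))
  simpa using h

/-- The reflection operator `(R f)(x) = f (-x)` on `L²[-1,1]`. -/
def reflI : L2I →L[ℂ] L2I :=
  (Lp.compMeasurePreservingₗᵢ ℂ (fun x : ℝ => -x) measurePreserving_neg_muI).toContinuousLinearMap

/-- The kernel `sin (c (x - t)) / (π (x - t))`. The value on the diagonal is irrelevant, since
only integrals in `t` are used. -/
def sincKernel (c x t : ℝ) : ℝ := Real.sin (c * (x - t)) / (Real.pi * (x - t))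

theorem measurable_sincKernel (c : ℝ) :
    Measurable (fun p : ℝ × ℝ => sincKernel c p.1 p.2) := by
  unfold sincKernel
  fun_prop

theorem abs_sincKernel_le (c x t : ℝ) : |sincKernel c x t| ≤ |c| / Real.pi := by
  unfold sincKernel
  rcases eq_or_ne (x - t) 0 with h | h
  · rw [h]
    simp only [mul_zero, div_zero, abs_zero]
    positivity
  · rw [abs_div, abs_mul, abs_of_pos Real.pi_pos, div_le_div_iff₀ (by positivity) (by positivity)]
    have := Real.abs_sin_le_abs (x := c * (x - t))
    rw [abs_mul] at this
    nlinarith [Real.pi_pos]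

theorem integrable_muI (f : L2I) : Integrable f muI :=
  (Lp.memLp f).integrable (by norm_num)

theorem integrable_sincKernel (c x : ℝ) (f : L2I) :
    Integrable (fun t => (sincKernel c x t : ℂ) * f t) muI := by
  refine (integrable_muI f).bdd_mul (c := |c| / Real.pi) ?_ ?_
  · exact (Complex.measurable_ofReal.comp
      ((measurable_sincKernel c).comp measurable_prodMk_left)).aestronglyMeasurable
  · refine Eventually.of_forall (fun t => ?_)
    rw [Complex.norm_real]
    exact abs_sincKernel_le c x t

theorem memLp_sincKernel (c : ℝ) (f : L2I) :
    MemLp (fun x : ℝ => ∫ t in Icc (-1 : ℝ) 1, (sincKernel c x t : ℂ) * f t) 2 muI := by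
  refine MemLp.of_bound ?_ (∫ t, |c| / Real.pi * ‖f t‖ ∂muI) (Eventually.of_forall fun x => ?_)
  · have hm : StronglyMeasurable
        (Function.uncurry fun x t : ℝ => (sincKernel c x t : ℂ) * f t) := by
      refine StronglyMeasurable.mul ?_ ?_
      · exact (Complex.measurable_ofReal.comp (measurable_sincKernel c)).stronglyMeasurable
      · exact (Lp.stronglyMeasurable f).comp_measurable measurable_snd
    exact (hm.integral_prod_right (ν := muI)).aestronglyMeasurable
  · refine norm_integral_le_of_norm_le ((integrable_muI f).norm.const_mul _)
      (Eventually.of_forall fun t => ?_)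
    rw [norm_mul, Complex.norm_real]
    exact mul_le_mul_of_nonneg_right (abs_sincKernel_le c x t) (norm_nonneg _)

/-- The integral operator `(Q_c f)(x) = ∫_{-1}^{1} sin (c (x - t)) / (π (x - t)) f(t) dt` on
`L²[-1,1]`. -/
def sincOp (c : ℝ) : L2I →ₗ[ℂ] L2I where
  toFun f := (memLp_sincKernel c f).toLp _
  map_add' f g := by
    rw [← MemLp.toLp_add]
    refine MemLp.toLp_congr _ _ (Eventually.of_forall fun x => ?_)
    simp only [Pi.add_apply]
    rw [← integral_add (integrable_sincKernel c x f) (integrable_sincKernel c x g)]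
    refine integral_congr_ae ?_
    filter_upwards [Lp.coeFn_add f g] with t ht
    rw [ht, Pi.add_apply, mul_add]
  map_smul' z f := by
    rw [RingHom.id_apply, ← MemLp.toLp_const_smul]
    refine MemLp.toLp_congr _ _ (Eventually.of_forall fun x => ?_)
    simp only [Pi.smul_apply]
    rw [← integral_smul]
    refine integral_congr_ae ?_
    filter_upwards [Lp.coeFn_smul z f] with t ht
    rw [ht, Pi.smul_apply, smul_eq_mul, smul_eq_mul]
    ring

/-- The operator `sin (c ξ) / (π ξ) + sin (c (2 - ξ)) / (π (2 - ξ)) R` on `L²[-1,1]`. -/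
def sincWeight (c ξ : ℝ) : L2I →L[ℂ] L2I :=
  ((Real.sin (c * ξ) / (Real.pi * ξ) : ℝ) : ℂ) • ContinuousLinearMap.id ℂ L2I
    + ((Real.sin (c * (2 - ξ)) / (Real.pi * (2 - ξ)) : ℝ) : ℂ) • reflI

end

/-! Everything is diagonal in the eigenfunctions of T. If Tφ = lφ with φ smooth on [-1,1], the
variable x = 1 - t turns the equation into (p w')' = r w with p = 2x - x² and r = l + c²(1 - x)². At
x = 0 this is singular with double exponent 0, so a solution smooth there is determined by its value
at 0. The recurrence for U_k(l)/k! is the Frobenius recurrence, whence φ(1 - ξ) = φ(1) u_l(ξ) on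
[0,1] with u_l(ξ) = ∑ U_k(l) ξ^k/k! (`IsHeunEigenfun.eq_heunSol`). Thus eigenspaces are
one-dimensional and U(ξ;T) must multiply φ by u_l(ξ).

T commutes with the finite Fourier transform F with kernel exp(icxt) (`heunT_expOp`), and Q_c =
(c/2π) F*F (`sincOp_eq_expOp`), so φ is an eigenfunction of Q_c, and of R by parity. Evaluating Q_c
φ at 1 and folding the integral about t = 0 gives the formula on φ
(`integral_sincKernel_mul_smoothRep`).

F*F is compact, self-adjoint and injective. Its eigenspaces are finite-dimensional, smooth and
T-invariant, and diagonalizing T on each shows that the eigenfunctions of T span a dense subspace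
(`heunEigenSpan_topologicalClosure`). Since T is nonpositive, only l ≤ 0 occurs, and there |u_l| is
bounded on [0,1] uniformly in l (`exists_abs_heunSol_le`). The diagonal operators with entries
u_l(ξ) are therefore bounded uniformly in ξ. By symmetry of T they agree with the series wherever it
converges, so they are its closure. Both sides of the formula are then bounded operators that agree
on a dense subspace. -/

noncomputable section

/-! ### Power series with geometrically bounded real coefficients -/

/-- The coefficients grow at most like `(k + 1) ^ m * (2 / 3) ^ k`. -/
def GeomBounded (b : ℕ → ℝ) : Prop :=
  ∃ C : ℝ, ∃ m : ℕ, ∀ k, |b k| ≤ C * ((k : ℝ) + 1) ^ m * (2 / 3 : ℝ) ^ k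

/-- The coefficients of the derivative of a power series. -/
def derivCoeff (b : ℕ → ℝ) (k : ℕ) : ℝ := ((k : ℝ) + 1) * b (k + 1)

/-- The coefficients of the product of a power series with the variable. -/
def shiftCoeff (b : ℕ → ℝ) : ℕ → ℝ
  | 0 => 0
  | k + 1 => b k

/-- The sum of a real power series. -/
def seriesSum (b : ℕ → ℝ) (x : ℝ) : ℝ := ∑' k, b k * x ^ k

/-- The polynomial factor in `GeomBounded` exists for this: differentiation costs one more power of
k + 1 and leaves the rate 2/3 unchanged. -/
theorem GeomBounded.derivCoeff {b : ℕ → ℝ} (hb : GeomBounded b) :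
    GeomBounded (derivCoeff b) := by
  obtain ⟨C, m, h⟩ := hb
  have hC : 0 ≤ C := by simpa using (abs_nonneg _).trans (h 0)
  refine ⟨C * 2 ^ m, m + 1, fun k => ?_⟩
  have hk : (0 : ℝ) ≤ k := Nat.cast_nonneg k
  have h1 := h (k + 1)
  push_cast at h1
  have h2 : ((k : ℝ) + 1 + 1) ^ m ≤ 2 ^ m * ((k : ℝ) + 1) ^ m := by
    rw [← mul_pow]
    exact pow_le_pow_left₀ (by positivity) (by linarith) m
  rw [_root_.derivCoeff, abs_mul, abs_of_nonneg (by positivity : (0 : ℝ) ≤ (k : ℝ) + 1)]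
  calc ((k : ℝ) + 1) * |b (k + 1)|
      ≤ ((k : ℝ) + 1) * (C * (2 ^ m * ((k : ℝ) + 1) ^ m) * (2 / 3 : ℝ) ^ k) := by
        gcongr
        refine h1.trans ?_
        gcongr ?_ * ?_
        · gcongr
        · exact pow_le_pow_of_le_one (by norm_num) (by norm_num) (Nat.le_succ k)
    _ = C * 2 ^ m * ((k : ℝ) + 1) ^ (m + 1) * (2 / 3 : ℝ) ^ k := by ring

theorem GeomBounded.shiftCoeff {b : ℕ → ℝ} (hb : GeomBounded b) :
    GeomBounded (shiftCoeff b) := by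
  obtain ⟨C, m, h⟩ := hb
  have hC : 0 ≤ C := by simpa using (abs_nonneg _).trans (h 0)
  refine ⟨C * (3 / 2), m, fun k => ?_⟩
  cases k with
  | zero => simp only [_root_.shiftCoeff, abs_zero]; positivity
  | succ k =>
    refine (h k).trans ?_
    push_cast
    calc C * ((k : ℝ) + 1) ^ m * (2 / 3 : ℝ) ^ k
        ≤ C * ((k : ℝ) + 1 + 1) ^ m * (2 / 3 : ℝ) ^ k := by gcongr; linarith
      _ = C * (3 / 2) * ((k : ℝ) + 1 + 1) ^ m * (2 / 3 : ℝ) ^ (k + 1) := by ring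

/-- The radius 5/4 exceeds 1, so that the series can be differentiated on a neighbourhood of [0,1],
and (2/3)(5/4) = 5/6 < 1. -/
theorem GeomBounded.summable_abs {b : ℕ → ℝ} (hb : GeomBounded b) :
    Summable fun k => |b k| * (5 / 4 : ℝ) ^ k := by
  obtain ⟨C, m, h⟩ := hb
  have h0 : Summable fun k : ℕ => (k : ℝ) ^ m * (5 / 6 : ℝ) ^ k :=
    summable_pow_mul_geometric_of_norm_lt_one m (by norm_num)
  have h1 := ((summable_nat_add_iff 1).2 h0).mul_left (C * (6 / 5))
  refine Summable.of_nonneg_of_le (fun k => by positivity) (fun k => ?_) h1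
  calc |b k| * (5 / 4 : ℝ) ^ k
      ≤ C * ((k : ℝ) + 1) ^ m * (2 / 3 : ℝ) ^ k * (5 / 4 : ℝ) ^ k := by
        gcongr; exact h k
    _ = C * ((k : ℝ) + 1) ^ m * (5 / 6 : ℝ) ^ k := by
        rw [mul_assoc, ← mul_pow]; norm_num
    _ = C * (6 / 5) * (((k + 1 : ℕ) : ℝ) ^ m * (5 / 6 : ℝ) ^ (k + 1)) := by
        push_cast; ring

theorem GeomBounded.summable {b : ℕ → ℝ} (hb : GeomBounded b) {x : ℝ} (hx : |x| ≤ 5 / 4) :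
    Summable fun k => b k * x ^ k := by
  refine Summable.of_norm_bounded hb.summable_abs fun k => ?_
  rw [Real.norm_eq_abs, abs_mul, abs_pow]
  gcongr

theorem GeomBounded.hasDerivAt {b : ℕ → ℝ} (hb : GeomBounded b) {x : ℝ} (hx : |x| < 5 / 4) :
    HasDerivAt (seriesSum b) (seriesSum (_root_.derivCoeff b) x) x := by
  have hs : Summable fun k : ℕ => (k : ℝ) * |b k| * (5 / 4 : ℝ) ^ (k - 1) := by
    rw [← summable_nat_add_iff 1]
    refine hb.derivCoeff.summable_abs.congr fun k => ?_
    rw [_root_.derivCoeff, abs_mul, abs_of_nonneg (by positivity : (0 : ℝ) ≤ (k : ℝ) + 1)]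
    simp
  have hmem : ∀ {y : ℝ}, y ∈ Metric.ball (0 : ℝ) (5 / 4) ↔ |y| < 5 / 4 := by
    intro y; simp
  have key := hasDerivAt_tsum_of_isPreconnected (g := fun k y => b k * y ^ k)
    (g' := fun k y => b k * ((k : ℝ) * y ^ (k - 1))) hs
    Metric.isOpen_ball (convex_ball (0 : ℝ) (5 / 4)).isPreconnected
    (fun k y _ => (hasDerivAt_pow k y).const_mul (b k))
    (fun k y hy => by
      have hy' : |y| ≤ 5 / 4 := (hmem.1 hy).le
      rw [Real.norm_eq_abs, abs_mul, abs_mul, abs_pow, Nat.abs_cast]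
      calc |b k| * ((k : ℝ) * |y| ^ (k - 1)) ≤ |b k| * ((k : ℝ) * (5 / 4 : ℝ) ^ (k - 1)) := by
            gcongr
        _ = _ := by ring)
    (hmem.2 hx) (hb.summable hx.le) (hmem.2 hx)
  have h2 : Summable fun k => b k * ((k : ℝ) * x ^ (k - 1)) := by
    rw [← summable_nat_add_iff 1]
    refine (hb.derivCoeff.summable hx.le).congr fun k => ?_
    simp [_root_.derivCoeff]; ring
  have e : seriesSum (_root_.derivCoeff b) x = ∑' k, b k * ((k : ℝ) * x ^ (k - 1)) := by
    rw [h2.tsum_eq_zero_add, seriesSum]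
    simp only [Nat.cast_zero, zero_mul, mul_zero, zero_add]
    refine tsum_congr fun k => ?_
    simp [_root_.derivCoeff]; ring
  rw [e]
  exact key

theorem GeomBounded.seriesSum_shiftCoeff {b : ℕ → ℝ} (hb : GeomBounded b) {x : ℝ}
    (hx : |x| ≤ 5 / 4) : seriesSum (_root_.shiftCoeff b) x = x * seriesSum b x := by
  rw [seriesSum, (hb.shiftCoeff.summable hx).tsum_eq_zero_add, seriesSum, ← tsum_mul_left]
  simp only [_root_.shiftCoeff, zero_mul, zero_add]
  exact tsum_congr fun k => by ring

theorem seriesSum_zero (b : ℕ → ℝ) : seriesSum b 0 = b 0 := by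
  rw [seriesSum, tsum_eq_single 0 fun k hk => by simp [hk]]
  simp

/-! ### The power series solution of the spheroidal equation -/

/-- The coefficients `U_k(l) / k!`. -/
def heunCoeff (c l : ℝ) : ℕ → ℝ
  | 0 => 1
  | 1 => (l + c ^ 2) / 2
  | 2 => ((l + c ^ 2 + 2) * heunCoeff c l 1 - 2 * c ^ 2 * heunCoeff c l 0) / 8
  | k + 3 =>
      ((l + c ^ 2 + ((k : ℝ) + 2) * ((k : ℝ) + 3)) * heunCoeff c l (k + 2)
        - 2 * c ^ 2 * heunCoeff c l (k + 1) + c ^ 2 * heunCoeff c l k)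
        / (2 * ((k : ℝ) + 3) ^ 2)

/-- Division by k! clears the factors k and k(k - 1) from the recurrence for U_k; what remains is
the Frobenius recurrence with leading coefficient 2(k + 1)². -/
theorem heunPoly_eval_div_factorial (c l : ℝ) (k : ℕ) :
    (heunPoly c k).eval (l : ℂ) / (k.factorial : ℂ) = (heunCoeff c l k : ℂ) := by
  suffices h : (heunPoly c k).eval (l : ℂ) = (k.factorial : ℂ) * (heunCoeff c l k : ℂ) by
    rw [h, mul_div_cancel_left₀]
    exact_mod_cast k.factorial_ne_zero
  induction k using Nat.strong_induction_on with
  | _ k ih =>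
    match k with
    | 0 => simp [heunPoly, heunCoeff]
    | 1 => simp [heunPoly, heunCoeff]; ring
    | 2 =>
      simp [heunPoly, heunCoeff]
      ring
    | k + 3 =>
      have h3 : (k : ℂ) + 3 ≠ 0 := by exact_mod_cast (Nat.succ_ne_zero (k + 2))
      simp only [heunPoly, Polynomial.eval_add, Polynomial.eval_sub, Polynomial.eval_mul,
        Polynomial.eval_C, Polynomial.eval_X, ih (k + 2) (by omega), ih (k + 1) (by omega),
        ih k (by omega), heunCoeff, Nat.factorial_succ]
      push_cast
      field_simp
      ring

theorem abs_heunCoeff_succ_le {c l L : ℝ} (hl : |l| ≤ L) (k : ℕ) :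
    |heunCoeff c l (k + 3)| ≤
      ((L + c ^ 2 + ((k : ℝ) + 2) * ((k : ℝ) + 3)) * |heunCoeff c l (k + 2)|
        + 2 * c ^ 2 * |heunCoeff c l (k + 1)| + c ^ 2 * |heunCoeff c l k|)
        / (2 * ((k : ℝ) + 3) ^ 2) := by
  rw [heunCoeff, abs_div, abs_of_pos (by positivity : (0 : ℝ) < 2 * ((k : ℝ) + 3) ^ 2)]
  gcongr
  have h1 : |l + c ^ 2 + ((k : ℝ) + 2) * ((k : ℝ) + 3)|
      ≤ L + c ^ 2 + ((k : ℝ) + 2) * ((k : ℝ) + 3) := by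
    rw [add_assoc, add_assoc]
    refine (abs_add_le _ _).trans (add_le_add hl (le_of_eq (abs_of_nonneg ?_)))
    positivity
  refine (abs_add_le _ _).trans (add_le_add ((abs_sub _ _).trans (add_le_add ?_ ?_)) ?_)
  · rw [abs_mul]; gcongr
  · rw [abs_mul, abs_of_nonneg (by positivity : (0 : ℝ) ≤ 2 * c ^ 2)]
  · rw [abs_mul, abs_of_nonneg (by positivity : (0 : ℝ) ≤ c ^ 2)]

/-- A crude bound, needed only for the finitely many coefficients that precede the geometric regime.
-/
theorem abs_heunCoeff_le_pow {c l L : ℝ} (hl : |l| ≤ L) (k : ℕ) :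
    |heunCoeff c l k| ≤ (1 + L + 4 * c ^ 2) ^ k := by
  have hL : 0 ≤ L := (abs_nonneg l).trans hl
  have hc : 0 ≤ c ^ 2 := sq_nonneg c
  have hD : 1 ≤ 1 + L + 4 * c ^ 2 := by linarith
  have h1 : |heunCoeff c l 1| ≤ 1 + L + 4 * c ^ 2 := by
    rw [heunCoeff, abs_le]
    rw [abs_le] at hl
    constructor <;> linarith
  induction k using Nat.strong_induction_on with
  | _ k ih =>
    match k with
    | 0 => simp [heunCoeff]
    | 1 => simpa using h1
    | 2 =>
      have e : heunCoeff c l 0 = 1 := rfl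
      rw [heunCoeff, e, abs_div, abs_of_pos (by norm_num : (0 : ℝ) < 8), div_le_iff₀ (by norm_num)]
      refine (abs_sub _ _).trans ?_
      rw [abs_mul, abs_of_nonneg (by linarith : 0 ≤ 2 * c ^ 2 * 1)]
      have h2 : |l + c ^ 2 + 2| ≤ 2 * (1 + L + 4 * c ^ 2) := by
        rw [abs_le] at hl ⊢
        constructor <;> linarith
      have h3 := mul_le_mul h2 h1 (abs_nonneg _) (by linarith)
      nlinarith
    | k + 3 =>
      refine (abs_heunCoeff_succ_le hl k).trans ?_
      rw [div_le_iff₀ (by positivity)]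
      set D := 1 + L + 4 * c ^ 2 with hDdef
      have i2 := ih (k + 2) (by omega)
      have i1 := (ih (k + 1) (by omega)).trans (pow_le_pow_right₀ hD (Nat.le_succ (k + 1)))
      have i0 := (ih k (by omega)).trans (pow_le_pow_right₀ hD (by omega : k ≤ k + 2))
      have hk : (0 : ℝ) ≤ k := Nat.cast_nonneg k
      calc (L + c ^ 2 + ((k : ℝ) + 2) * ((k : ℝ) + 3)) * |heunCoeff c l (k + 2)|
            + 2 * c ^ 2 * |heunCoeff c l (k + 1)| + c ^ 2 * |heunCoeff c l k|
          ≤ (L + c ^ 2 + ((k : ℝ) + 2) * ((k : ℝ) + 3)) * D ^ (k + 2)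
            + 2 * c ^ 2 * D ^ (k + 2) + c ^ 2 * D ^ (k + 2) := by gcongr
        _ = (L + 4 * c ^ 2 + ((k : ℝ) + 2) * ((k : ℝ) + 3)) * D ^ (k + 2) := by ring
        _ ≤ (D * (2 * ((k : ℝ) + 3) ^ 2)) * D ^ (k + 2) := by
            gcongr
            have hM : 0 ≤ L + 4 * c ^ 2 := by linarith
            have h9 : (0 : ℝ) ≤ 2 * ((k : ℝ) + 3) ^ 2 - 1 := by nlinarith
            rw [hDdef]
            nlinarith [mul_nonneg hM h9]
        _ = D ^ (k + 3) * (2 * ((k : ℝ) + 3) ^ 2) := by ring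

/-- The ratio (k + 2)(k + 3)/(2(k + 3)²) tends to 1/2, reflecting the next singular point x = 2, so
the rate 2/3 is eventually reproduced by the recurrence. The index where this begins depends on c
and L only, hence C is uniform in l. -/
theorem exists_abs_heunCoeff_le (c : ℝ) {L : ℝ} (hL : 0 ≤ L) :
    ∃ C : ℝ, 0 ≤ C ∧ ∀ l : ℝ, |l| ≤ L → ∀ k, |heunCoeff c l k| ≤ C * (2 / 3 : ℝ) ^ k := by
  have hc : 0 ≤ c ^ 2 := sq_nonneg c
  set D := 1 + L + 4 * c ^ 2 with hDdef
  have hD : 1 ≤ D := by linarith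
  -- For j ≥ K, (4/3)(j + 3)² - (j + 2)(j + 3) = (j + 3)(j/3 + 2) dominates L + (25/4)c², where 25/4
  -- = 1 + 2·(3/2) + (3/2)².
  obtain ⟨K, hK⟩ := exists_nat_ge (3 * (L + 7 * c ^ 2))
  have hr : (0 : ℝ) < (2 / 3 : ℝ) ^ (K + 3) := by positivity
  refine ⟨D ^ (K + 3) / (2 / 3 : ℝ) ^ (K + 3), by positivity, fun l hl k => ?_⟩
  set C := D ^ (K + 3) / (2 / 3 : ℝ) ^ (K + 3) with hC
  have hC0 : 0 ≤ C := by positivity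
  induction k using Nat.strong_induction_on with
  | _ k ih =>
    by_cases hk : k ≤ K + 3
    · calc |heunCoeff c l k| ≤ D ^ k := abs_heunCoeff_le_pow hl k
        _ ≤ D ^ (K + 3) := pow_le_pow_right₀ hD hk
        _ = C * (2 / 3 : ℝ) ^ (K + 3) := by rw [hC, div_mul_cancel₀ _ hr.ne']
        _ ≤ C * (2 / 3 : ℝ) ^ k := by
          gcongr ?_ * ?_
          exact pow_le_pow_of_le_one (by norm_num) (by norm_num) hk
    · obtain ⟨j, rfl⟩ : ∃ j, k = j + 3 := ⟨k - 3, by omega⟩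
      have hj : (K : ℝ) ≤ j := by exact_mod_cast (by omega : K ≤ j)
      have hj0 : (0 : ℝ) ≤ j := Nat.cast_nonneg j
      refine (abs_heunCoeff_succ_le hl j).trans ?_
      rw [div_le_iff₀ (by positivity)]
      have i2 := ih (j + 2) (by omega)
      have i1 := ih (j + 1) (by omega)
      have i0 := ih j (by omega)
      calc (L + c ^ 2 + ((j : ℝ) + 2) * ((j : ℝ) + 3)) * |heunCoeff c l (j + 2)|
            + 2 * c ^ 2 * |heunCoeff c l (j + 1)| + c ^ 2 * |heunCoeff c l j|
          ≤ (L + c ^ 2 + ((j : ℝ) + 2) * ((j : ℝ) + 3)) * (C * (2 / 3 : ℝ) ^ (j + 2))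
            + 2 * c ^ 2 * (C * (2 / 3 : ℝ) ^ (j + 1)) + c ^ 2 * (C * (2 / 3 : ℝ) ^ j) := by
            gcongr
        _ = (L + (25 / 4) * c ^ 2 + ((j : ℝ) + 2) * ((j : ℝ) + 3))
              * (C * (2 / 3 : ℝ) ^ (j + 2)) := by ring
        _ ≤ ((4 / 3) * ((j : ℝ) + 3) ^ 2) * (C * (2 / 3 : ℝ) ^ (j + 2)) := by
            gcongr
            nlinarith
        _ = C * (2 / 3 : ℝ) ^ (j + 3) * (2 * ((j : ℝ) + 3) ^ 2) := by ring

theorem geomBounded_heunCoeff (c l : ℝ) : GeomBounded (heunCoeff c l) := by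
  obtain ⟨C, -, h⟩ := exists_abs_heunCoeff_le c (abs_nonneg l)
  exact ⟨C, 0, fun k => by simpa using h l le_rfl k⟩

/-- The solution `u(x) = ∑ U_k(l) x ^ k / k!` of the spheroidal equation that is regular at the
singular point `x = 0`, where it takes the value `1`. -/
def heunSol (c l : ℝ) : ℝ → ℝ := seriesSum (heunCoeff c l)

/-- The derivative of `heunSol`. -/
def heunSolDeriv (c l : ℝ) : ℝ → ℝ := seriesSum (derivCoeff (heunCoeff c l))

theorem heunSol_zero (c l : ℝ) : heunSol c l 0 = 1 := seriesSum_zero _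

theorem hasDerivAt_heunSol (c l : ℝ) {x : ℝ} (hx : |x| < 5 / 4) :
    HasDerivAt (heunSol c l) (heunSolDeriv c l x) x :=
  (geomBounded_heunCoeff c l).hasDerivAt hx

/-- This is Tg = lg after the substitution x ↦ 1 - x. Multiplication by x shifts coefficients, so
comparing coefficients of x^k reduces the equation to the recurrence. -/
theorem exists_hasDerivAt_heunSolDeriv (c l : ℝ) {x : ℝ} (hx : |x| < 5 / 4) :
    ∃ v : ℝ, HasDerivAt (heunSolDeriv c l) v x ∧
      (2 * x - x ^ 2) * v + (2 - 2 * x) * heunSolDeriv c l x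
        = (l + c ^ 2 * (1 - x) ^ 2) * heunSol c l x := by
  have ha := geomBounded_heunCoeff c l
  refine ⟨_, ha.derivCoeff.hasDerivAt hx, ?_⟩
  have hx' := hx.le
  set a := heunCoeff c l with haa
  have s1 := ha.seriesSum_shiftCoeff hx'
  have s2 := ha.shiftCoeff.seriesSum_shiftCoeff hx'
  have s3 := ha.derivCoeff.seriesSum_shiftCoeff hx'
  have s4 := ha.derivCoeff.derivCoeff.seriesSum_shiftCoeff hx'
  have s5 := ha.derivCoeff.derivCoeff.shiftCoeff.seriesSum_shiftCoeff hx'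
  have t0 := (ha.summable hx').hasSum
  have t1 := (ha.shiftCoeff.summable hx').hasSum
  have t2 := (ha.shiftCoeff.shiftCoeff.summable hx').hasSum
  have t3 := (ha.derivCoeff.summable hx').hasSum
  have t4 := (ha.derivCoeff.shiftCoeff.summable hx').hasSum
  have t5 := (ha.derivCoeff.derivCoeff.shiftCoeff.summable hx').hasSum
  have t6 := (ha.derivCoeff.derivCoeff.shiftCoeff.shiftCoeff.summable hx').hasSum
  have hl := ((t5.mul_left 2).sub t6).add ((t3.mul_left 2).sub (t4.mul_left 2))
  have hr := ((t0.mul_left (l + c ^ 2)).sub (t1.mul_left (2 * c ^ 2))).add (t2.mul_left (c ^ 2))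
  have key := hl.tsum_eq.symm.trans ((tsum_congr fun k => ?_).trans hr.tsum_eq)
  · change 2 * seriesSum _ x - seriesSum _ x + (2 * seriesSum _ x - 2 * seriesSum _ x)
      = (l + c ^ 2) * seriesSum _ x - 2 * c ^ 2 * seriesSum _ x + c ^ 2 * seriesSum _ x at key
    rw [s5, s4, s3, s2, s1] at key
    change (2 * x - x ^ 2) * seriesSum (derivCoeff (derivCoeff a)) x
      + (2 - 2 * x) * seriesSum (derivCoeff a) x = (l + c ^ 2 * (1 - x) ^ 2) * seriesSum a x
    linear_combination key
  · match k with
    | 0 =>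
      simp [shiftCoeff, derivCoeff, haa, heunCoeff]
      ring
    | 1 =>
      simp [shiftCoeff, derivCoeff, haa, heunCoeff]
      ring
    | k + 2 =>
      have h3 : (k : ℝ) + 3 ≠ 0 := by positivity
      have h4 : (2 * ((k : ℝ) + 3) ^ 2) * a (k + 3) =
          (l + c ^ 2 + ((k : ℝ) + 2) * ((k : ℝ) + 3)) * a (k + 2)
            - 2 * c ^ 2 * a (k + 1) + c ^ 2 * a k := by
        rw [haa, heunCoeff]
        field_simp
      simp only [shiftCoeff, derivCoeff]
      push_cast
      linear_combination x ^ (k + 2) * h4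

/-! ### Bounds and uniqueness for the spheroidal equation -/

/-- Sonin's energy argument. With p = 2x - x² and q = -l - c²(1 - x)² the equation is (p u')' + q u
= 0, and E = u² + (p/q) u'² satisfies E' = -((pq)'/q²) u'² ≤ 0, because p and q are nonnegative and
nondecreasing on [0,1]. Since p(0) = 0, E(0) = u(0)² = 1. The hypothesis on l makes q positive. -/
theorem abs_heunSol_le_one {c l : ℝ} (hl : l < -c ^ 2) {x : ℝ} (hx : x ∈ Icc (0 : ℝ) 1) :
    |heunSol c l x| ≤ 1 := by
  have hab : ∀ y ∈ Icc (0 : ℝ) 1, |y| < 5 / 4 := fun y hy => by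
    rw [abs_of_nonneg hy.1]; linarith [hy.2]
  have hq : ∀ y ∈ Icc (0 : ℝ) 1, 0 < -l - c ^ 2 * (1 - y) ^ 2 := fun y hy => by
    have : (1 - y) ^ 2 ≤ 1 := by nlinarith [hy.1, hy.2]
    nlinarith [sq_nonneg c]
  set E : ℝ → ℝ := fun y => heunSol c l y ^ 2
    + (2 * y - y ^ 2) / (-l - c ^ 2 * (1 - y) ^ 2) * heunSolDeriv c l y ^ 2 with hE
  have hd : ∀ y ∈ Icc (0 : ℝ) 1, ∃ e ≤ 0, HasDerivAt E e y := by
    intro y hy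
    obtain ⟨v, hv, hode⟩ := exists_hasDerivAt_heunSolDeriv c l (hab y hy)
    have h1 := (hasDerivAt_heunSol c l (hab y hy)).pow 2
    have hp : HasDerivAt (fun y : ℝ => 2 * y - y ^ 2) (2 - 2 * y) y := by
      exact (((hasDerivAt_id y).const_mul 2).sub (hasDerivAt_pow 2 y)).congr_deriv (by simp)
    have hqd : HasDerivAt (fun y : ℝ => -l - c ^ 2 * (1 - y) ^ 2) (2 * c ^ 2 * (1 - y)) y := by
      have := ((((hasDerivAt_id y).const_sub 1).pow 2).const_mul (c ^ 2)).const_sub (-l)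
      refine this.congr_deriv ?_
      simp; ring
    have h2 := h1.add ((hp.div hqd (hq y hy).ne').mul (hv.pow 2))
    refine ⟨_, ?_, h2⟩
    have hq0 := hq y hy
    set q := -l - c ^ 2 * (1 - y) ^ 2 with hqq
    set u := heunSol c l y
    set w := heunSolDeriv c l y
    have e1 : (2 * y - y ^ 2) * v = -(2 - 2 * y) * w - q * u := by
      rw [hqq]; linear_combination hode
    have hy1 : 0 ≤ 1 - y := by linarith [hy.2]
    have hp0 : 0 ≤ 2 * y - y ^ 2 := by nlinarith [hy.1, hy.2]
    have : 0 ≤ ((2 - 2 * y) / q + (2 * y - y ^ 2) * (2 * c ^ 2 * (1 - y)) / q ^ 2) * w ^ 2 := by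
      have : 0 ≤ 2 - 2 * y := by linarith
      positivity
    refine le_of_eq_of_le ?_ (neg_nonpos.2 this)
    change (2 : ℕ) * u ^ 1 * w + (((2 - 2 * y) * q - (2 * y - y ^ 2) * (2 * c ^ 2 * (1 - y))) / q ^ 2
      * w ^ 2 + (2 * y - y ^ 2) / q * ((2 : ℕ) * w ^ 1 * v)) = _
    clear_value q
    push_cast
    field_simp
    linear_combination q * w * e1
  have hanti : AntitoneOn E (Icc 0 1) := by
    choose! e he hed using hd
    refine antitoneOn_of_deriv_nonpos (convex_Icc 0 1)
      (fun y hy => (hed y hy).continuousAt.continuousWithinAt)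
      (fun y hy => (hed y (interior_subset hy)).differentiableAt.differentiableWithinAt)
      (fun y hy => ?_)
    rw [(hed y (interior_subset hy)).deriv]
    exact he y (interior_subset hy)
  have h0 : E 0 = 1 := by simp [hE, heunSol_zero]
  have hle : E x ≤ 1 := h0 ▸ hanti (left_mem_Icc.2 zero_le_one) hx hx.1
  have hpx : 0 ≤ 2 * x - x ^ 2 := by nlinarith [hx.1, hx.2]
  have hqx := hq x hx
  have : 0 ≤ (2 * x - x ^ 2) / (-l - c ^ 2 * (1 - x) ^ 2) * heunSolDeriv c l x ^ 2 := by
    positivity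
  rw [← sq_le_one_iff_abs_le_one]
  simp only [hE] at hle
  linarith

/-- The energy bound covers l < -c²; the remaining l in [-c², 0] form a bounded set, where the
uniform coefficient bound applies. -/
theorem exists_abs_heunSol_le (c : ℝ) :
    ∃ M : ℝ, ∀ l ≤ 0, ∀ x ∈ Icc (0 : ℝ) 1, |heunSol c l x| ≤ M := by
  obtain ⟨C, hC, h⟩ := exists_abs_heunCoeff_le c (sq_nonneg c)
  refine ⟨max 1 (∑' k : ℕ, C * (2 / 3 : ℝ) ^ k), fun l hl x hx => ?_⟩
  by_cases hlc : l < -c ^ 2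
  · exact (abs_heunSol_le_one hlc hx).trans (le_max_left _ _)
  · refine le_trans ?_ (le_max_right _ _)
    have hs : Summable fun k : ℕ => C * (2 / 3 : ℝ) ^ k :=
      (summable_geometric_of_lt_one (by norm_num) (by norm_num)).mul_left C
    change ‖∑' k, heunCoeff c l k * x ^ k‖ ≤ _
    refine tsum_of_norm_bounded hs.hasSum fun k => ?_
    rw [Real.norm_eq_abs, abs_mul, abs_pow, abs_of_nonneg hx.1]
    calc |heunCoeff c l k| * x ^ k ≤ |heunCoeff c l k| * 1 := by
          gcongr; exact pow_le_one₀ hx.1 hx.2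
      _ ≤ C * (2 / 3 : ℝ) ^ k := by
          rw [mul_one]; exact h l (by rw [abs_of_nonpos hl]; linarith) k

/-- A solution of the spheroidal equation that is regular at `x = 0` and vanishes there is zero. -/
theorem eq_zero_of_spheroidal {b : ℝ} (hb : b < 2) {w w' r : ℝ → ℂ} (hr : Continuous r)
    (hw : ∀ x ∈ Icc (0 : ℝ) b, HasDerivAt w (w' x) x)
    (hw' : ∀ x ∈ Icc (0 : ℝ) b, HasDerivAt (fun x : ℝ => (2 * x - x ^ 2 : ℂ) * w' x)
      (r x * w x) x)
    (hc : ContinuousOn w' (Icc 0 b)) (h0 : w 0 = 0) : ∀ x ∈ Icc (0 : ℝ) b, w x = 0 := by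
  have hwc : ContinuousOn w (Icc 0 b) := fun x hx => (hw x hx).continuousAt.continuousWithinAt
  obtain ⟨K, hK⟩ := isCompact_Icc.exists_bound_of_continuousOn (hr.continuousOn (s := Icc 0 b))
  obtain ⟨M, hM⟩ := isCompact_Icc.exists_bound_of_continuousOn hwc
  intro x hx
  have hb0 : 0 ≤ b := hx.1.trans hx.2
  have hK0 : 0 ≤ K := (norm_nonneg _).trans (hK 0 ⟨le_rfl, hb0⟩)
  have hM0 : 0 ≤ M := (norm_nonneg _).trans (hM 0 ⟨le_rfl, hb0⟩)
  set κ := K / (2 - b) with hκ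
  have h2b : 0 < 2 - b := by linarith
  have hκ0 : 0 ≤ κ := by positivity
  have hKκ : K = κ * (2 - b) := by rw [hκ, div_mul_cancel₀ _ h2b.ne']
  have hpowd : ∀ (A : ℝ) (n : ℕ) (y : ℝ), HasDerivAt
      (fun y : ℝ => A * (y ^ (n + 1) / ((n + 1).factorial : ℝ))) (A * (y ^ n / (n.factorial : ℝ))) y := by
    intro A n y
    have := ((hasDerivAt_pow (n + 1) y).div_const ((n + 1).factorial : ℝ)).const_mul A
    refine this.congr_deriv ?_
    have hn : ((n : ℝ) + 1) ≠ 0 := by positivity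
    have hf : (n.factorial : ℝ) ≠ 0 := by exact_mod_cast n.factorial_ne_zero
    rw [Nat.factorial_succ]
    push_cast
    field_simp
  -- Picard iteration: integrating r w bounds p w' by a multiple of y^(n+1); dividing by p = y(2 -
  -- y) ≥ y(2 - b) cancels one power of y, which absorbs the singularity; a second integration then
  -- raises n by one, at the cost of a factor κ.
  have step : ∀ n : ℕ, ∀ y ∈ Icc (0 : ℝ) b,
      ‖w y‖ ≤ M * κ ^ n * (y ^ n / (n.factorial : ℝ)) := by
    intro n
    induction n with
    | zero => intro y hy; simpa using hM y hy
    | succ n ih =>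
      have hP : ∀ y ∈ Icc (0 : ℝ) b, ‖(2 * y - y ^ 2 : ℂ) * w' y‖
          ≤ K * (M * κ ^ n) * (y ^ (n + 1) / ((n + 1).factorial : ℝ)) := by
        refine image_norm_le_of_norm_deriv_right_le_deriv_boundary
          (f := fun y : ℝ => (2 * y - y ^ 2 : ℂ) * w' y) (f' := fun y => r y * w y)
          (fun y hy => (hw' y hy).continuousAt.continuousWithinAt)
          (fun y hy => (hw' y (Ico_subset_Icc_self hy)).hasDerivWithinAt)
          (by simp) (hpowd _ n) (fun y hy => ?_)
        rw [norm_mul, mul_assoc]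
        exact mul_le_mul (hK y (Ico_subset_Icc_self hy)) (ih y (Ico_subset_Icc_self hy))
          (norm_nonneg _) hK0
      have hW : ∀ y ∈ Ioc (0 : ℝ) b, ‖w' y‖ ≤ M * κ ^ (n + 1) * (y ^ n / (n.factorial : ℝ)) := by
        intro y hy
        have h1 := hP y ⟨hy.1.le, hy.2⟩
        have hp : (2 * y - y ^ 2 : ℂ) = ((y * (2 - y) : ℝ) : ℂ) := by push_cast; ring
        have h2y : 0 < 2 - y := by linarith [hy.2]
        have hy0 := hy.1
        rw [hp, norm_mul, Complex.norm_real, Real.norm_of_nonneg (by positivity)] at h1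
        have hf : (0 : ℝ) < n.factorial := by exact_mod_cast n.factorial_pos
        have h3 : K * (M * κ ^ n) * (y ^ (n + 1) / ((n + 1).factorial : ℝ))
            ≤ (y * (2 - y)) * (M * κ ^ (n + 1) * (y ^ n / (n.factorial : ℝ))) := by
          rw [hKκ]
          have h4 : (y ^ (n + 1) / ((n + 1).factorial : ℝ)) ≤ y ^ (n + 1) / (n.factorial : ℝ) := by
            gcongr
            exact Nat.le_succ n
          calc κ * (2 - b) * (M * κ ^ n) * (y ^ (n + 1) / ((n + 1).factorial : ℝ))
              ≤ κ * (2 - y) * (M * κ ^ n) * (y ^ (n + 1) / (n.factorial : ℝ)) := by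
                gcongr
                exact hy.2
            _ = _ := by ring
        exact le_of_mul_le_mul_left (h1.trans h3) (by positivity)
      intro y hy
      rcases hy.1.eq_or_lt with h | h
      · rw [← h, h0]; simp
      have hb1 : 0 < b := h.trans_le hy.2
      -- At z = 0 the division by p is impossible, so the bound is obtained as a limit from the
      -- right; this is where regularity of w' at the singular point enters.
      have hbd : ∀ z ∈ Ico (0 : ℝ) b, ‖w' z‖ ≤ M * κ ^ (n + 1) * (z ^ n / (n.factorial : ℝ)) := by
        intro z hz
        rcases hz.1.eq_or_lt with hz0 | hz0
        · subst hz0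
          have hmem : ∀ᶠ z in 𝓝[>] (0 : ℝ), z ∈ Ioc (0 : ℝ) b := Ioc_mem_nhdsGT hb1
          have l1 : Tendsto (fun z => ‖w' z‖) (𝓝[>] (0 : ℝ)) (𝓝 ‖w' 0‖) := by
            refine ((hc 0 ⟨le_rfl, hb0⟩).mono_left ?_).norm
            exact nhdsWithin_le_of_mem (mem_of_superset hmem Ioc_subset_Icc_self)
          have l2 : Tendsto (fun z : ℝ => M * κ ^ (n + 1) * (z ^ n / (n.factorial : ℝ)))
              (𝓝[>] (0 : ℝ)) (𝓝 (M * κ ^ (n + 1) * ((0 : ℝ) ^ n / (n.factorial : ℝ)))) :=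
            Tendsto.mono_left (Continuous.tendsto (by fun_prop) 0) nhdsWithin_le_nhds
          exact le_of_tendsto_of_tendsto l1 l2 (hmem.mono hW)
        · exact hW z ⟨hz0, hz.2.le⟩
      exact image_norm_le_of_norm_deriv_right_le_deriv_boundary hwc
        (fun z hz => (hw z (Ico_subset_Icc_self hz)).hasDerivWithinAt)
        (by simp [h0]) (hpowd _ n) hbd hy
  have hlim : Tendsto (fun n : ℕ => M * ((κ * x) ^ n / (n.factorial : ℝ))) atTop (𝓝 (M * 0)) :=
    (FloorSemiring.tendsto_pow_div_factorial_atTop (κ * x)).const_mul M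
  rw [mul_zero] at hlim
  have : ‖w x‖ ≤ 0 := ge_of_tendsto' hlim fun n => by
    refine (step n x hx).trans (le_of_eq ?_)
    rw [mul_pow]; ring
  exact norm_le_zero_iff.1 this

/-! ### The finite Fourier transform -/

/-- The function `x ↦ ∫_{-1}^{1} exp (κ x t) f(t) dt`. -/
def expInt (κ : ℂ) (f : ℝ → ℂ) (x : ℝ) : ℂ := ∫ t, Complex.exp (κ * x * t) * f t ∂muI

theorem ae_abs_le_one_muI : ∀ᵐ t ∂muI, |t| ≤ 1 :=
  (ae_restrict_iff' measurableSet_Icc).2 (Eventually.of_forall fun _ ht => abs_le.2 ht)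

theorem integrable_continuous_mul_muI {g f : ℝ → ℂ} (hg : Continuous g) (hf : Integrable f muI) :
    Integrable (fun t => g t * f t) muI := by
  obtain ⟨C, hC⟩ := (isCompact_Icc (a := (-1 : ℝ)) (b := 1)).exists_bound_of_continuousOn
    hg.continuousOn
  exact hf.bdd_mul hg.aestronglyMeasurable
    ((ae_restrict_iff' measurableSet_Icc).2 (Eventually.of_forall hC))

theorem integrable_muI_of_continuous {g : ℝ → ℂ} (hg : Continuous g) : Integrable g muI :=
  (memLp_of_continuous_muI hg).integrable (by norm_num)

theorem expInt_congr (κ : ℂ) {f g : ℝ → ℂ} (h : f =ᵐ[muI] g) : expInt κ f = expInt κ g := by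
  funext x
  exact integral_congr_ae (h.mono fun t ht => by simp only [ht])

theorem norm_exp_mul_le (κ : ℂ) (x : ℝ) {t : ℝ} (ht : |t| ≤ 1) :
    ‖Complex.exp (κ * x * t)‖ ≤ Real.exp (‖κ‖ * |x|) := by
  refine (Complex.norm_exp_le_exp_norm _).trans (Real.exp_le_exp.2 ?_)
  rw [norm_mul, norm_mul, Complex.norm_real, Complex.norm_real, Real.norm_eq_abs, Real.norm_eq_abs]
  exact mul_le_of_le_one_right (by positivity) ht

theorem hasDerivAt_expInt (κ : ℂ) {f : ℝ → ℂ} (hf : Integrable f muI) (x : ℝ) :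
    HasDerivAt (expInt κ f) (expInt κ (fun t => κ * t * f t) x) x := by
  refine (hasDerivAt_integral_of_dominated_loc_of_deriv_le (μ := muI)
    (F := fun (y t : ℝ) => Complex.exp (κ * y * t) * f t)
    (F' := fun (y t : ℝ) => Complex.exp (κ * y * t) * (κ * t * f t))
    (bound := fun t => Real.exp (‖κ‖ * (|x| + 1)) * (‖κ‖ * ‖f t‖))
    (Metric.ball_mem_nhds x one_pos) ?_ ?_ ?_ ?_ ?_ ?_).2
  · exact Eventually.of_forall fun y =>
      (integrable_continuous_mul_muI (by fun_prop) hf).aestronglyMeasurable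
  · exact integrable_continuous_mul_muI (by fun_prop) hf
  · exact (integrable_continuous_mul_muI (by fun_prop)
      (integrable_continuous_mul_muI (by fun_prop) hf)).aestronglyMeasurable
  · filter_upwards [ae_abs_le_one_muI] with t ht y hy
    rw [norm_mul, norm_mul, norm_mul, Complex.norm_real, Real.norm_eq_abs]
    have h1 : |y| ≤ |x| + 1 := by
      rw [Metric.mem_ball, Real.dist_eq] at hy
      linarith [abs_sub_abs_le_abs_sub y x]
    refine mul_le_mul ((norm_exp_mul_le κ y ht).trans (Real.exp_le_exp.2 (by gcongr))) ?_
      (by positivity) (by positivity)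
    gcongr
    exact mul_le_of_le_one_right (norm_nonneg _) ht
  · exact (hf.norm.const_mul _).const_mul _
  · refine Eventually.of_forall fun t y _ => ?_
    have h0 : HasDerivAt (fun y : ℝ => (y : ℂ)) 1 y := Complex.ofRealCLM.hasDerivAt
    have h1 : HasDerivAt (fun y : ℝ => Complex.exp (κ * y * t))
        (Complex.exp (κ * y * t) * (κ * 1 * t)) y := ((h0.const_mul κ).mul_const (t : ℂ)).cexp
    refine (h1.mul_const (f t)).congr_deriv ?_
    ring

theorem deriv_expInt (κ : ℂ) {f : ℝ → ℂ} (hf : Integrable f muI) :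
    deriv (expInt κ f) = expInt κ (fun t => κ * t * f t) :=
  funext fun x => (hasDerivAt_expInt κ hf x).deriv

theorem contDiff_expInt (κ : ℂ) {f : ℝ → ℂ} (hf : Integrable f muI) :
    ContDiff ℝ ∞ (expInt κ f) := by
  rw [contDiff_infty]
  intro n
  induction n generalizing f with
  | zero =>
    exact contDiff_zero.2
      (continuous_iff_continuousAt.2 fun x => (hasDerivAt_expInt κ hf x).continuousAt)
  | succ n ih =>
    push_cast
    refine contDiff_succ_iff_deriv.2
      ⟨fun x => (hasDerivAt_expInt κ hf x).differentiableAt, by simp, ?_⟩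
    rw [deriv_expInt κ hf]
    exact ih (integrable_continuous_mul_muI (by fun_prop) hf)

theorem norm_le_of_ae_bound_muI {f : L2I} {C : ℝ} (hC : 0 ≤ C) (h : ∀ᵐ x ∂muI, ‖f x‖ ≤ C) :
    ‖f‖ ≤ 2 * C := by
  refine (Lp.norm_le_of_ae_bound hC h).trans ?_
  gcongr
  have h1 : (measureUnivNNReal muI : ℝ) = 2 := by
    change (muI univ).toReal = 2
    rw [Measure.restrict_apply_univ, Real.volume_Icc, ENNReal.toReal_ofReal (by norm_num)]
    norm_num
  rw [h1]
  calc (2 : ℝ) ^ ((2 : ENNReal).toReal⁻¹) ≤ 2 ^ (1 : ℝ) :=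
        Real.rpow_le_rpow_of_exponent_le (by norm_num) (by norm_num)
    _ = 2 := Real.rpow_one 2

/-- The class of `t ^ n`. -/
def monoI (n : ℕ) : L2I :=
  (memLp_of_continuous_muI (g := fun t : ℝ => (t : ℂ) ^ n) (by fun_prop)).toLp _

theorem monoI_ae (n : ℕ) : monoI n =ᵐ[muI] fun t : ℝ => (t : ℂ) ^ n := MemLp.coeFn_toLp _

theorem norm_monoI_le (n : ℕ) : ‖monoI n‖ ≤ 2 := by
  have := norm_le_of_ae_bound_muI (f := monoI n) zero_le_one (by
    filter_upwards [monoI_ae n, ae_abs_le_one_muI] with t ht h1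
    rw [ht, norm_pow, Complex.norm_real, Real.norm_eq_abs]
    exact pow_le_one₀ (abs_nonneg t) h1)
  linarith

theorem inner_muI (f g : L2I) : inner ℂ f g = ∫ t, g t * (starRingEnd ℂ) (f t) ∂muI := by
  rw [L2.inner_def]
  simp [RCLike.inner_apply]

theorem inner_monoI (n : ℕ) (f : L2I) : inner ℂ (monoI n) f = ∫ t, (t : ℂ) ^ n * f t ∂muI := by
  rw [inner_muI]
  refine integral_congr_ae ?_
  filter_upwards [monoI_ae n] with t ht
  rw [ht, map_pow, Complex.conj_ofReal, mul_comm]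

/-- The terms of the expansion of the integral operator with kernel `exp (κ x t)`. -/
def expTerm (κ : ℂ) (n : ℕ) : L2I →L[ℂ] L2I :=
  (κ ^ n / (n.factorial : ℂ)) • InnerProductSpace.rankOne ℂ (monoI n) (monoI n)

theorem summable_expTerm (κ : ℂ) : Summable (expTerm κ) := by
  refine Summable.of_norm_bounded ((Real.summable_pow_div_factorial ‖κ‖).mul_right 4) fun n => ?_
  rw [expTerm, norm_smul, InnerProductSpace.norm_rankOne, norm_div, norm_pow,
    Complex.norm_natCast]
  have := norm_monoI_le n
  gcongr
  nlinarith [norm_nonneg (monoI n)]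

/-- The integral operator with kernel `exp (κ x t)` on `L²[-1,1]`. -/
def expOp (κ : ℂ) : L2I →L[ℂ] L2I := ∑' n, expTerm κ n

/-- The Taylor expansion of the kernel presents the operator as a norm limit of finite-rank
operators. -/
theorem isCompactOperator_expOp (κ : ℂ) : IsCompactOperator (expOp κ) := by
  refine isCompactOperator_of_tendsto (summable_expTerm κ).hasSum.tendsto_sum_nat
    (Eventually.of_forall fun N => ?_)
  have h : ∀ n, expTerm κ n ∈ compactOperator (RingHom.id ℂ) L2I L2I := by
    intro n
    refine Submodule.smul_mem _ _ ?_
    change IsCompactOperator _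
    rw [InnerProductSpace.rankOne_def']
    exact (isCompactOperator_of_locallyCompactSpace_rng
      (ContinuousLinearMap.toSpanSingleton ℂ (monoI n))).comp_clm (innerSL ℂ (monoI n))
  exact Submodule.sum_mem _ fun n _ => h n

theorem adjoint_expOp (κ : ℂ) :
    ContinuousLinearMap.adjoint (expOp κ) = expOp ((starRingEnd ℂ) κ) := by
  have h := (summable_expTerm κ).hasSum.map
    (ContinuousLinearMap.adjoint (𝕜 := ℂ) (E := L2I) (F := L2I))
    (ContinuousLinearMap.adjoint (𝕜 := ℂ) (E := L2I) (F := L2I)).continuous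
  refine h.tsum_eq.symm.trans (tsum_congr fun n => ?_)
  simp only [Function.comp_apply, expTerm]
  rw [map_smulₛₗ, InnerProductSpace.adjoint_rankOne, map_div₀, map_pow, map_natCast]

theorem expOp_ae (κ : ℂ) (f : L2I) : expOp κ f =ᵐ[muI] expInt κ f := by
  have hcont := (contDiff_expInt κ (integrable_muI f)).continuous
  suffices h : expOp κ f = (memLp_of_continuous_muI hcont).toLp _ by
    rw [h]; exact MemLp.coeFn_toLp _
  set F := (memLp_of_continuous_muI hcont).toLp _ with hF
  have h1 : Tendsto (fun N => (∑ n ∈ Finset.range N, expTerm κ n) f) atTop (𝓝 (expOp κ f)) :=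
    ((ContinuousLinearMap.apply ℂ L2I f).continuous.tendsto _).comp
      (summable_expTerm κ).hasSum.tendsto_sum_nat
  refine tendsto_nhds_unique h1 ?_
  rw [tendsto_iff_norm_sub_tendsto_zero]
  have hlim : Tendsto (fun N : ℕ => 2 * ((‖κ‖ ^ N / (N.factorial : ℝ) * 2) * ∫ t, ‖f t‖ ∂muI))
      atTop (𝓝 0) := by
    have := (((FloorSemiring.tendsto_pow_div_factorial_atTop ‖κ‖).mul_const 2).mul_const
      (∫ t, ‖f t‖ ∂muI)).const_mul 2
    simpa using this
  refine squeeze_zero' (Eventually.of_forall fun _ => norm_nonneg _) ?_ hlim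
  -- From this N on, the Taylor remainder of exp on the disc of radius ‖κ‖ is at most twice its
  -- first omitted term.
  filter_upwards [eventually_ge_atTop ⌈2 * ‖κ‖⌉₊] with N hN
  have hN' : ‖κ‖ / (N.succ : ℝ) ≤ 1 / 2 := by
    have : 2 * ‖κ‖ ≤ N := Nat.ceil_le.1 hN
    rw [div_le_iff₀ (by positivity)]
    push_cast
    linarith
  refine norm_le_of_ae_bound_muI (by positivity) ?_
  have hsum : ((∑ n ∈ Finset.range N, expTerm κ n) f : L2I) =ᵐ[muI]
      fun x => ∑ n ∈ Finset.range N,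
        κ ^ n / (n.factorial : ℂ) * ((∫ t, (t : ℂ) ^ n * f t ∂muI) * (x : ℂ) ^ n) := by
    rw [sum_apply]
    have hall : ∀ᵐ x ∂muI, ∀ n ∈ Finset.range N, (expTerm κ n f : L2I) x =
        κ ^ n / (n.factorial : ℂ) * ((∫ t, (t : ℂ) ^ n * f t ∂muI) * (x : ℂ) ^ n) := by
      rw [Finset.eventually_all]
      intro n _
      have e : expTerm κ n f =
          (κ ^ n / (n.factorial : ℂ) * (∫ t, (t : ℂ) ^ n * f t ∂muI)) • monoI n := by
        rw [expTerm, smul_apply, InnerProductSpace.rankOne_apply, inner_monoI,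
          smul_smul]
      rw [e]
      filter_upwards [Lp.coeFn_smul (κ ^ n / (n.factorial : ℂ) * (∫ t, (t : ℂ) ^ n * f t ∂muI))
        (monoI n), monoI_ae n] with x h2 h3
      rw [h2, Pi.smul_apply, h3, smul_eq_mul, mul_assoc]
    filter_upwards [hall, Lp.coeFn_finsetSum (Finset.range N) (fun n => expTerm κ n f)] with x h2 h3
    rw [h3, Finset.sum_apply]
    exact Finset.sum_congr rfl h2
  filter_upwards [hsum, Lp.coeFn_sub ((∑ n ∈ Finset.range N, expTerm κ n) f) F,
    MemLp.coeFn_toLp (memLp_of_continuous_muI hcont), ae_abs_le_one_muI] with x h2 h3 h4 hx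
  rw [h3, Pi.sub_apply, h2, hF, h4, expInt]
  have hint : ∀ n : ℕ, Integrable (fun t : ℝ => (t : ℂ) ^ n * f t) muI := fun n =>
    integrable_continuous_mul_muI (by fun_prop) (integrable_muI f)
  have e : ∑ n ∈ Finset.range N,
        κ ^ n / (n.factorial : ℂ) * ((∫ t, (t : ℂ) ^ n * f t ∂muI) * (x : ℂ) ^ n)
      = ∫ t, (∑ n ∈ Finset.range N, (κ * x * t) ^ n / (n.factorial : ℂ)) * f t ∂muI := by
    simp_rw [Finset.sum_mul]
    rw [integral_finsetSum]
    · refine Finset.sum_congr rfl fun n _ => ?_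
      rw [← integral_mul_const, ← integral_const_mul]
      refine integral_congr_ae (Eventually.of_forall fun t => ?_)
      simp only [mul_pow]
      ring
    · exact fun n _ => integrable_continuous_mul_muI (by fun_prop) (integrable_muI f)
  rw [e, ← integral_sub (integrable_continuous_mul_muI (by fun_prop) (integrable_muI f))
    (integrable_continuous_mul_muI (by fun_prop) (integrable_muI f)), ← integral_const_mul]
  refine norm_integral_le_of_norm_le ((integrable_muI f).norm.const_mul _) ?_
  filter_upwards [ae_abs_le_one_muI] with t ht
  rw [← sub_mul, norm_mul]
  gcongr
  have hz : ‖κ * x * t‖ ≤ ‖κ‖ := by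
    rw [norm_mul, norm_mul, Complex.norm_real, Complex.norm_real, Real.norm_eq_abs,
      Real.norm_eq_abs, mul_assoc]
    exact mul_le_of_le_one_right (norm_nonneg _)
      (mul_le_one₀ hx (abs_nonneg _) ht)
  rw [norm_sub_rev]
  refine (Complex.exp_bound' (n := N) ((div_le_div_of_nonneg_right hz (by positivity)).trans hN')).trans ?_
  gcongr

theorem continuous_eqOn_of_ae_muI {g h : ℝ → ℂ} (hg : Continuous g) (hh : Continuous h)
    (hgh : g =ᵐ[muI] h) : EqOn g h (Icc (-1) 1) := by
  have h0 : g =ᵐ[volume.restrict (Ioo (-1 : ℝ) 1)] h :=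
    ae_restrict_of_ae_restrict_of_subset Ioo_subset_Icc_self hgh
  have h1 : EqOn g h (Ioo (-1 : ℝ) 1) :=
    Measure.eqOn_open_of_ae_eq h0 isOpen_Ioo hg.continuousOn hh.continuousOn
  have h2 := h1.closure hg hh
  rwa [closure_Ioo (by norm_num)] at h2

/-- By Weierstrass approximation on [-1,1], vanishing against polynomials gives vanishing against
smooth test functions. -/
theorem eq_zero_of_moments_eq_zero (f : L2I) (h : ∀ n : ℕ, ∫ t, (t : ℂ) ^ n * f t ∂muI = 0) :
    f = 0 := by
  have hf := integrable_muI f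
  have hpoly : ∀ p : Polynomial ℝ, ∫ t, ((p.eval t : ℝ) : ℂ) * f t ∂muI = 0 := by
    intro p
    have e : ∀ t : ℝ, ((p.eval t : ℝ) : ℂ) * f t
        = ∑ n ∈ Finset.range (p.natDegree + 1), (p.coeff n : ℂ) * ((t : ℂ) ^ n * f t) := by
      intro t
      rw [Polynomial.eval_eq_sum_range]
      push_cast
      rw [Finset.sum_mul]
      exact Finset.sum_congr rfl fun n _ => by ring
    simp_rw [e]
    rw [integral_finsetSum]
    · exact Finset.sum_eq_zero fun n _ => by rw [integral_const_mul, h, mul_zero]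
    · exact fun n _ => (integrable_continuous_mul_muI (by fun_prop) hf).const_mul _
  refine (Lp.eq_zero_iff_ae_eq_zero).2 ?_
  refine ae_eq_zero_of_integral_contDiff_smul_eq_zero hf.locallyIntegrable fun g hg _ => ?_
  rw [← norm_le_zero_iff]
  refine le_of_forall_pos_le_add fun ε hε => ?_
  have hI : 0 ≤ ∫ t, ‖f t‖ ∂muI := integral_nonneg fun _ => norm_nonneg _
  set δ := ε / ((∫ t, ‖f t‖ ∂muI) + 1) with hδ
  have hδ0 : 0 < δ := by positivity
  obtain ⟨p, hp⟩ := exists_polynomial_near_of_continuousOn (-1) 1 g hg.continuous.continuousOn δ hδ0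
  have e : ∫ t, g t • f t ∂muI = ∫ t, ((g t : ℂ) - ((p.eval t : ℝ) : ℂ)) * f t ∂muI := by
    simp_rw [sub_mul]
    rw [integral_sub, hpoly p, sub_zero]
    · simp
    · exact integrable_continuous_mul_muI (Complex.continuous_ofReal.comp hg.continuous) hf
    · exact integrable_continuous_mul_muI (Complex.continuous_ofReal.comp p.continuous) hf
  rw [e]
  calc ‖∫ t, ((g t : ℂ) - ((p.eval t : ℝ) : ℂ)) * f t ∂muI‖ ≤ ∫ t, δ * ‖f t‖ ∂muI := by
        refine norm_integral_le_of_norm_le (hf.norm.const_mul _) ?_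
        refine (ae_restrict_iff' measurableSet_Icc).2 (Eventually.of_forall fun t ht => ?_)
        rw [norm_mul, ← Complex.ofReal_sub, Complex.norm_real, norm_sub_rev]
        gcongr
        exact (hp t ht).le
    _ = δ * ∫ t, ‖f t‖ ∂muI := integral_const_mul _ _
    _ ≤ 0 + ε := by
        rw [hδ, zero_add, div_mul_eq_mul_div, div_le_iff₀ (by positivity)]
        nlinarith

/-- The n-th derivative of the transform at 0 is κ^n times the n-th moment of f. -/
theorem expOp_injective {κ : ℂ} (hκ : κ ≠ 0) {f : L2I} (hf : expOp κ f = 0) : f = 0 := by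
  have h0 : EqOn (expInt κ f) (fun _ => 0) (Ioo (-1) 1) :=
    (continuous_eqOn_of_ae_muI (contDiff_expInt κ (integrable_muI f)).continuous continuous_const
      ((expOp_ae κ f).symm.trans (by rw [hf]; exact Lp.coeFn_zero _ _ _))).mono Ioo_subset_Icc_self
  have key : ∀ n : ℕ, EqOn (expInt κ (fun t => (κ * t) ^ n * f t)) (fun _ => 0) (Ioo (-1) 1) := by
    intro n
    induction n with
    | zero => simpa using h0
    | succ n ih =>
      intro x hx
      have hi : Integrable (fun t : ℝ => (κ * t) ^ n * f t) muI :=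
        integrable_continuous_mul_muI (by fun_prop) (integrable_muI f)
      have h1 := hasDerivAt_expInt κ hi x
      have h2 : HasDerivAt (expInt κ (fun t => (κ * t) ^ n * f t)) 0 x :=
        (hasDerivAt_const x (0 : ℂ)).congr_of_eventuallyEq
          (ih.eventuallyEq_of_mem (isOpen_Ioo.mem_nhds hx))
      have h3 := h1.unique h2
      simpa only [pow_succ', mul_assoc] using h3
  refine eq_zero_of_moments_eq_zero f fun n => ?_
  have h1 := key n (show (0 : ℝ) ∈ Ioo (-1 : ℝ) 1 by norm_num)
  simp only [expInt, Complex.ofReal_zero, mul_zero, zero_mul, Complex.exp_zero, one_mul, mul_pow,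
    mul_assoc] at h1
  rw [integral_const_mul] at h1
  exact (mul_eq_zero.1 h1).resolve_left (pow_ne_zero n hκ)

/-! ### Symmetry of the Heun operator -/

theorem integral_muI_eq (g : ℝ → ℂ) : ∫ t, g t ∂muI = ∫ t in (-1 : ℝ)..1, g t := by
  rw [intervalIntegral.integral_of_le (by norm_num), integral_Icc_eq_integral_Ioc]

/-- Integration by parts; the boundary terms vanish because 1 - t² does at ±1. The pairing has no
conjugation, so it serves the kernel exp(κxt) as well as the inner product. -/
theorem integral_heunExpr_mul (c : ℝ) {g h : ℝ → ℂ} (hg : ContDiff ℝ ∞ g) (hh : ContDiff ℝ ∞ h) :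
    ∫ t, heunExpr c g t * h t ∂muI = -(∫ t, (1 - (t : ℂ) ^ 2) * (deriv g t * deriv h t) ∂muI)
      - (c : ℂ) ^ 2 * ∫ t, (t : ℂ) ^ 2 * (g t * h t) ∂muI := by
  have n0 : (∞ : WithTop ℕ∞) ≠ 0 := by simp
  have hg1 := contDiff_deriv_of_smooth hg
  have hg2 := contDiff_deriv_of_smooth hg1
  have hh1 := contDiff_deriv_of_smooth hh
  have c0 := hg.continuous
  have c1 := hg1.continuous
  have c2 := hg2.continuous
  have d0 := hh.continuous
  have d1 := hh1.continuous
  have hP : ∀ x : ℝ, HasDerivAt (fun x : ℝ => (1 - (x : ℂ) ^ 2) * deriv g x)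
      ((1 - (x : ℂ) ^ 2) * deriv (deriv g) x - 2 * (x : ℂ) * deriv g x) x := by
    intro x
    have h0 : HasDerivAt (fun y : ℝ => (y : ℂ)) 1 x := Complex.ofRealCLM.hasDerivAt
    have h1 := ((h0.pow 2).const_sub 1).mul (hg1.differentiable n0 x).hasDerivAt
    refine h1.congr_deriv ?_
    simp
    ring
  have hH : ∀ x : ℝ, HasDerivAt h (deriv h x) x := fun x => (hh.differentiable n0 x).hasDerivAt
  have key := intervalIntegral.integral_mul_deriv_eq_deriv_mul (a := -1) (b := 1)
    (fun x _ => hH x) (fun x _ => hP x) (Continuous.intervalIntegrable (by fun_prop) _ _)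
    (Continuous.intervalIntegrable (by fun_prop) _ _)
  simp only [Complex.ofReal_one, one_pow, sub_self, zero_mul, mul_zero, Complex.ofReal_neg,
    neg_one_sq, zero_sub] at key
  rw [integral_muI_eq, integral_muI_eq, integral_muI_eq, ← intervalIntegral.integral_const_mul]
  have e1 : ∫ t in (-1 : ℝ)..1, heunExpr c g t * h t
      = ∫ t in (-1 : ℝ)..1, (h t * ((1 - (t : ℂ) ^ 2) * deriv (deriv g) t - 2 * (t : ℂ) * deriv g t)
        - (c : ℂ) ^ 2 * ((t : ℂ) ^ 2 * (g t * h t))) := by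
    refine intervalIntegral.integral_congr fun t _ => ?_
    simp only [heunExpr]
    ring
  rw [e1, intervalIntegral.integral_sub (Continuous.intervalIntegrable (by fun_prop) _ _)
    (Continuous.intervalIntegrable (by fun_prop) _ _), key]
  congr 2
  refine intervalIntegral.integral_congr fun t _ => ?_
  ring

theorem integral_heunExpr_mul_comm (c : ℝ) {g h : ℝ → ℂ} (hg : ContDiff ℝ ∞ g)
    (hh : ContDiff ℝ ∞ h) :
    ∫ t, heunExpr c g t * h t ∂muI = ∫ t, g t * heunExpr c h t ∂muI := by
  simp_rw [mul_comm (g _) (heunExpr c h _)]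
  rw [integral_heunExpr_mul c hg hh, integral_heunExpr_mul c hh hg]
  simp_rw [mul_comm (deriv h _), mul_comm (h _)]

theorem contDiff_conj {g : ℝ → ℂ} (hg : ContDiff ℝ ∞ g) :
    ContDiff ℝ ∞ (fun x => (starRingEnd ℂ) (g x)) :=
  Complex.conjCLE.contDiff.comp hg

theorem deriv_conj {g : ℝ → ℂ} (hg : ContDiff ℝ ∞ g) :
    deriv (fun x => (starRingEnd ℂ) (g x)) = fun x => (starRingEnd ℂ) (deriv g x) := by
  funext x
  have h1 := (hg.differentiable (by simp) x).hasDerivAt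
  exact (Complex.conjCLE.toContinuousLinearMap.hasFDerivAt.comp_hasDerivAt x h1).deriv

theorem heunExpr_conj (c : ℝ) {g : ℝ → ℂ} (hg : ContDiff ℝ ∞ g) :
    heunExpr c (fun x => (starRingEnd ℂ) (g x)) = fun x => (starRingEnd ℂ) (heunExpr c g x) := by
  funext x
  simp only [heunExpr, deriv_conj hg, deriv_conj (contDiff_deriv_of_smooth hg), map_sub,
    map_mul, map_pow, map_one, Complex.conj_ofReal, map_ofNat]

theorem heunT_ae (c : ℝ) (f : smoothI) {g : ℝ → ℂ} (hg : ContDiff ℝ ∞ g)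
    (hfg : (f : L2I) =ᵐ[muI] g) : (heunT c f : L2I) =ᵐ[muI] heunExpr c g :=
  heunFun_ae c f hg hfg

theorem heunT_isSymmetric (c : ℝ) : (heunT c).IsSymmetric := by
  intro f g
  have hf := smoothRep_contDiff f
  have hg := smoothRep_contDiff g
  change inner ℂ (heunT c f : L2I) (g : L2I) = inner ℂ (f : L2I) (heunT c g : L2I)
  rw [inner_muI, inner_muI]
  have e1 : ∫ t, (g : L2I) t * (starRingEnd ℂ) ((heunT c f : L2I) t) ∂muI
      = ∫ t, smoothRep g t * heunExpr c (fun x => (starRingEnd ℂ) (smoothRep f x)) t ∂muI := by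
    refine integral_congr_ae ?_
    filter_upwards [heunT_ae c f hf (smoothRep_ae f), smoothRep_ae g] with t h1 h2
    rw [h1, h2, heunExpr_conj c hf]
  have e2 : ∫ t, (heunT c g : L2I) t * (starRingEnd ℂ) ((f : L2I) t) ∂muI
      = ∫ t, heunExpr c (smoothRep g) t * (starRingEnd ℂ) (smoothRep f t) ∂muI := by
    refine integral_congr_ae ?_
    filter_upwards [heunT_ae c g hg (smoothRep_ae g), smoothRep_ae f] with t h1 h2
    rw [h1, h2]
  rw [e1, e2, integral_heunExpr_mul_comm c hg (contDiff_conj hf)]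

theorem re_inner_heunT_nonpos (c : ℝ) (f : smoothI) :
    (inner ℂ (f : L2I) (heunT c f : L2I)).re ≤ 0 := by
  have hf := smoothRep_contDiff f
  rw [inner_muI]
  have e2 : ∫ t, (heunT c f : L2I) t * (starRingEnd ℂ) ((f : L2I) t) ∂muI
      = ∫ t, heunExpr c (smoothRep f) t * (starRingEnd ℂ) (smoothRep f t) ∂muI := by
    refine integral_congr_ae ?_
    filter_upwards [heunT_ae c f hf (smoothRep_ae f), smoothRep_ae f] with t h1 h2
    rw [h1, h2]
  rw [e2, integral_heunExpr_mul c hf (contDiff_conj hf), deriv_conj hf]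
  have e3 : ∫ t, (1 - (t : ℂ) ^ 2) * (deriv (smoothRep f) t * (starRingEnd ℂ) (deriv (smoothRep f) t))
      ∂muI = ((∫ t, (1 - t ^ 2) * ‖deriv (smoothRep f) t‖ ^ 2 ∂muI : ℝ) : ℂ) := by
    rw [← integral_complex_ofReal]
    refine integral_congr_ae (Eventually.of_forall fun t => ?_)
    simp only [Complex.mul_conj']
    push_cast
    rfl
  have e4 : ∫ t, (t : ℂ) ^ 2 * (smoothRep f t * (starRingEnd ℂ) (smoothRep f t))
      ∂muI = ((∫ t, t ^ 2 * ‖smoothRep f t‖ ^ 2 ∂muI : ℝ) : ℂ) := by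
    rw [← integral_complex_ofReal]
    refine integral_congr_ae (Eventually.of_forall fun t => ?_)
    simp only [Complex.mul_conj']
    push_cast
    rfl
  have h3 : 0 ≤ ∫ t, (1 - t ^ 2) * ‖deriv (smoothRep f) t‖ ^ 2 ∂muI := by
    refine integral_nonneg_of_ae ?_
    filter_upwards [ae_abs_le_one_muI] with t ht
    have : t ^ 2 ≤ 1 := (sq_le_one_iff_abs_le_one t).2 ht
    have : 0 ≤ 1 - t ^ 2 := by linarith
    simp only [Pi.zero_apply]
    positivity
  have h4 : 0 ≤ ∫ t, t ^ 2 * ‖smoothRep f t‖ ^ 2 ∂muI := integral_nonneg fun t => by positivity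
  rw [e3, e4, ← Complex.ofReal_neg, ← Complex.ofReal_pow, ← Complex.ofReal_mul,
    ← Complex.ofReal_sub, Complex.ofReal_re]
  have := mul_nonneg (sq_nonneg c) h4
  linarith

/-! ### The Heun operator commutes with the finite Fourier transform -/

/-- Applying T in x and T in t to exp(κxt) gives results that differ by the factor (κ² + c²)(t² -
x²), which is zero; symmetry then moves T from the kernel to f. -/
theorem heunExpr_expInt {c : ℝ} {κ : ℂ} (hκ : κ ^ 2 = -(c : ℂ) ^ 2) {f : ℝ → ℂ}
    (hf : ContDiff ℝ ∞ f) : heunExpr c (expInt κ f) = expInt κ (heunExpr c f) := by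
  have hfi := integrable_muI_of_continuous hf.continuous
  have hc := hf.continuous
  have hfi1 : Integrable (fun t : ℝ => κ * t * f t) muI :=
    integrable_continuous_mul_muI (by fun_prop) hfi
  funext x
  have hk : ContDiff ℝ ∞ (fun t : ℝ => Complex.exp (κ * x * t)) := by
    have : ContDiff ℝ ∞ (fun t : ℝ => (t : ℂ)) := Complex.ofRealCLM.contDiff
    fun_prop
  have hk1 : ∀ a : ℂ, deriv (fun t : ℝ => a * Complex.exp (κ * x * t))
      = fun t : ℝ => (a * (κ * x)) * Complex.exp (κ * x * t) := by
    intro a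
    funext t
    have h0 : HasDerivAt (fun y : ℝ => (y : ℂ)) 1 t := Complex.ofRealCLM.hasDerivAt
    refine (((h0.const_mul (κ * x)).cexp).const_mul a).deriv.trans ?_
    ring
  have hd1 : deriv (fun t : ℝ => Complex.exp (κ * x * t))
      = fun t : ℝ => (κ * x) * Complex.exp (κ * x * t) := by
    simpa using hk1 1
  have hkT : ∀ t : ℝ, heunExpr c (fun t : ℝ => Complex.exp (κ * x * t)) t
      = ((1 - (t : ℂ) ^ 2) * (κ * x) ^ 2 - 2 * t * (κ * x) - (c : ℂ) ^ 2 * (t : ℂ) ^ 2)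
        * Complex.exp (κ * x * t) := by
    intro t
    simp only [heunExpr, hd1, hk1]
    ring
  have e : expInt κ (heunExpr c f) x
      = ∫ t, heunExpr c (fun t : ℝ => Complex.exp (κ * x * t)) t * f t ∂muI :=
    (integral_heunExpr_mul_comm c hk hf).symm
  rw [e, heunExpr, deriv_expInt κ hfi, deriv_expInt κ hfi1]
  simp only [expInt]
  rw [← integral_const_mul, ← integral_const_mul, ← integral_const_mul, ← integral_sub,
    ← integral_sub]
  · refine integral_congr_ae (Eventually.of_forall fun t => ?_)
    simp only [hkT]
    linear_combination ((1 - (x : ℂ) ^ 2) * (t : ℂ) ^ 2 - (1 - (t : ℂ) ^ 2) * (x : ℂ) ^ 2)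
      * Complex.exp (κ * x * t) * f t * hκ
  all_goals exact integrable_muI_of_continuous (by fun_prop)

theorem expOp_mem_smoothI (κ : ℂ) (f : L2I) : expOp κ f ∈ smoothI :=
  ⟨_, contDiff_expInt κ (integrable_muI f), expOp_ae κ f⟩

theorem heunT_expOp {c : ℝ} {κ : ℂ} (hκ : κ ^ 2 = -(c : ℂ) ^ 2) (f : smoothI) :
    (heunT c ⟨expOp κ f, expOp_mem_smoothI κ f⟩ : L2I) = expOp κ (heunT c f : L2I) := by
  apply Lp.ext
  have hf := smoothRep_contDiff f
  refine (heunT_ae c _ (contDiff_expInt κ (integrable_muI f)) (expOp_ae κ f)).trans ?_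
  rw [expInt_congr κ (smoothRep_ae f), heunExpr_expInt hκ hf,
    ← expInt_congr κ (heunT_ae c f hf (smoothRep_ae f))]
  exact (expOp_ae κ _).symm

/-! ### The sinc kernel operator -/

theorem integral_exp_eq_sincKernel {c x t : ℝ} (hc : 0 < c) (hxt : x ≠ t) :
    ∫ s in (-1 : ℝ)..1, Complex.exp (-(c * Complex.I) * x * s) * Complex.exp (c * Complex.I * s * t)
      = (2 * Real.pi / c : ℝ) * (sincKernel c x t : ℂ) := by
  have hz : (c : ℂ) * Complex.I * (t - x) ≠ 0 := by
    refine mul_ne_zero (mul_ne_zero (by exact_mod_cast hc.ne') Complex.I_ne_zero) ?_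
    rw [sub_ne_zero]
    exact_mod_cast hxt.symm
  have e1 : ∀ s : ℝ, Complex.exp (-(c * Complex.I) * x * s) * Complex.exp (c * Complex.I * s * t)
      = Complex.exp ((c : ℂ) * Complex.I * (t - x) * s) := by
    intro s
    rw [← Complex.exp_add]
    congr 1
    ring
  simp_rw [e1]
  rw [integral_exp_mul_complex hz, sincKernel]
  have hx : (x : ℂ) - t ≠ 0 := by
    rw [sub_ne_zero]
    exact_mod_cast hxt
  have hp : (Real.pi : ℂ) ≠ 0 := by exact_mod_cast Real.pi_ne_zero
  have hc' : (c : ℂ) ≠ 0 := by exact_mod_cast hc.ne'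
  push_cast
  rw [div_mul_div_comm, div_eq_div_iff hz (mul_ne_zero hc' (mul_ne_zero hp hx)), Complex.sin]
  have e2 : Complex.exp ((c : ℂ) * Complex.I * (t - x) * 1)
      = Complex.exp (-((c : ℂ) * (x - t)) * Complex.I) := by congr 1; ring
  have e3 : Complex.exp ((c : ℂ) * Complex.I * (t - x) * -1)
      = Complex.exp (((c : ℂ) * (x - t)) * Complex.I) := by congr 1; ring
  rw [e2, e3]
  linear_combination (Complex.exp (((c : ℂ) * (x - t)) * Complex.I)
    - Complex.exp (-((c : ℂ) * (x - t)) * Complex.I)) * (c * Real.pi * (t - x)) * Complex.I_mul_I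

theorem expInt_expInt_eq_integral_sincKernel {c : ℝ} (hc : 0 < c) {f : ℝ → ℂ}
    (hf : Integrable f muI) (x : ℝ) :
    expInt (-(c * Complex.I)) (expInt (c * Complex.I) f) x
      = (2 * Real.pi / c : ℝ) * ∫ t, (sincKernel c x t : ℂ) * f t ∂muI := by
  have e1 : expInt (-(c * Complex.I)) (expInt (c * Complex.I) f) x
      = ∫ s, ∫ t, Complex.exp (-(c * Complex.I) * x * s) *
          Complex.exp (c * Complex.I * s * t) * f t ∂muI ∂muI := by
    refine integral_congr_ae (Eventually.of_forall fun s => ?_)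
    simp only [expInt]
    rw [← integral_const_mul]
    simp only [mul_assoc]
  rw [e1, integral_integral_swap, ← integral_const_mul]
  · refine integral_congr_ae ?_
    -- The diagonal must be discarded: there `sincKernel` is 0 by the convention for division by
    -- zero, while the integral over s equals 2.
    have hne : ∀ᵐ t ∂muI, t ≠ x := by
      refine ae_restrict_of_ae ?_
      exact (measure_singleton x : volume {x} = 0) |> fun h => compl_mem_ae_iff.2 h
    filter_upwards [hne] with t ht
    rw [integral_mul_const, integral_muI_eq, integral_exp_eq_sincKernel hc ht.symm, mul_assoc]
  · have h1 : Integrable (fun p : ℝ × ℝ => f p.2) (muI.prod muI) := by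
      simpa using (integrable_const (1 : ℂ) (μ := muI)).mul_prod hf
    refine h1.bdd_mul (c := Real.exp (‖(c : ℂ) * Complex.I‖ * |x|)
      * Real.exp (‖(c : ℂ) * Complex.I‖ * 1)) ?_ ?_
    · exact Continuous.aestronglyMeasurable (by fun_prop)
    · have h2 : ∀ᵐ p ∂(muI.prod muI), |p.1| ≤ 1 :=
        Measure.quasiMeasurePreserving_fst.ae ae_abs_le_one_muI
      have h3 : ∀ᵐ p ∂(muI.prod muI), |p.2| ≤ 1 :=
        Measure.quasiMeasurePreserving_snd.ae ae_abs_le_one_muI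
      filter_upwards [h2, h3] with p hp hq
      rw [norm_mul]
      refine mul_le_mul ?_ ?_ (norm_nonneg _) (Real.exp_pos _).le
      · simpa using norm_exp_mul_le (-(c * Complex.I)) x hp
      · refine (norm_exp_mul_le (c * Complex.I) p.1 hq).trans (Real.exp_le_exp.2 ?_)
        gcongr

theorem sincOp_ae (c : ℝ) (f : L2I) :
    sincOp c f =ᵐ[muI] fun x => ∫ t, (sincKernel c x t : ℂ) * f t ∂muI :=
  MemLp.coeFn_toLp (memLp_sincKernel c f)

theorem sincOp_eq_expOp {c : ℝ} (hc : 0 < c) (f : L2I) :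
    sincOp c f = ((c / (2 * Real.pi) : ℝ) : ℂ) •
      expOp (-(c * Complex.I)) (expOp (c * Complex.I) f) := by
  apply Lp.ext
  refine (sincOp_ae c f).trans ?_
  filter_upwards [Lp.coeFn_smul ((c / (2 * Real.pi) : ℝ) : ℂ)
    (expOp (-(c * Complex.I)) (expOp (c * Complex.I) f)),
    expOp_ae (-(c * Complex.I)) (expOp (c * Complex.I) f)] with x h1 h2
  rw [h1, Pi.smul_apply, h2, expInt_congr _ (expOp_ae (c * Complex.I) f),
    expInt_expInt_eq_integral_sincKernel hc (integrable_muI f), smul_eq_mul, ← mul_assoc,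
    ← Complex.ofReal_mul]
  have : c / (2 * Real.pi) * (2 * Real.pi / c) = 1 := by
    have := Real.pi_ne_zero
    field_simp
  rw [this]
  simp

/-! ### Eigenfunctions of the Heun operator -/

/-- `g` is a smooth function that satisfies the eigenvalue equation on `[-1,1]`. -/
structure IsHeunEigenfun (c l : ℝ) (g : ℝ → ℂ) : Prop where
  contDiff : ContDiff ℝ ∞ g
  eq : ∀ x ∈ Icc (-1 : ℝ) 1, heunExpr c g x = l * g x

theorem IsHeunEigenfun.smul {c l : ℝ} {g : ℝ → ℂ} (hg : IsHeunEigenfun c l g) (z : ℂ) :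
    IsHeunEigenfun c l (z • g) := by
  refine ⟨hg.contDiff.const_smul z, fun x hx => ?_⟩
  rw [heunExpr_smul c z hg.contDiff, Pi.smul_apply, Pi.smul_apply, hg.eq x hx, smul_eq_mul,
    smul_eq_mul]
  ring

theorem IsHeunEigenfun.add {c l : ℝ} {g h : ℝ → ℂ} (hg : IsHeunEigenfun c l g)
    (hh : IsHeunEigenfun c l h) : IsHeunEigenfun c l (g + h) := by
  refine ⟨hg.contDiff.add hh.contDiff, fun x hx => ?_⟩
  rw [heunExpr_add c hg.contDiff hh.contDiff, Pi.add_apply, Pi.add_apply, hg.eq x hx, hh.eq x hx]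
  ring

theorem heunExpr_comp_neg (c : ℝ) (g : ℝ → ℂ) (x : ℝ) :
    heunExpr c (fun y => g (-y)) x = heunExpr c g (-x) := by
  have h1 : ∀ f : ℝ → ℂ, deriv (fun y => f (-y)) = fun y => -deriv f (-y) :=
    fun f => funext fun y => deriv_comp_neg f y
  have h2 : deriv (fun y => -deriv g (-y)) = fun y => deriv (deriv g) (-y) := by
    funext y
    rw [deriv.fun_neg, h1 (deriv g), neg_neg]
  simp only [heunExpr, h1 g, h2]
  push_cast
  ring

theorem IsHeunEigenfun.comp_neg {c l : ℝ} {g : ℝ → ℂ} (hg : IsHeunEigenfun c l g) :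
    IsHeunEigenfun c l (fun y => g (-y)) := by
  refine ⟨hg.contDiff.comp contDiff_neg, fun x hx => ?_⟩
  rw [heunExpr_comp_neg, hg.eq (-x) ⟨by linarith [hx.2], by linarith [hx.1]⟩]

theorem IsHeunEigenfun.expInt {c l : ℝ} {κ : ℂ} (hκ : κ ^ 2 = -(c : ℂ) ^ 2) {g : ℝ → ℂ}
    (hg : IsHeunEigenfun c l g) : IsHeunEigenfun c l (expInt κ g) := by
  refine ⟨contDiff_expInt κ (integrable_muI_of_continuous hg.contDiff.continuous), fun x _ => ?_⟩
  rw [heunExpr_expInt hκ hg.contDiff, _root_.expInt, _root_.expInt, ← integral_const_mul]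
  refine integral_congr_ae ((ae_restrict_iff' measurableSet_Icc).2 (Eventually.of_forall ?_))
  intro t ht
  simp only [hg.eq t ht]
  ring

theorem IsHeunEigenfun.hasDerivAt_comp_one_sub {c l : ℝ} {g : ℝ → ℂ} (hg : IsHeunEigenfun c l g)
    (x : ℝ) : HasDerivAt (fun x => g (1 - x)) (-deriv g (1 - x)) x := by
  have h1 := (hg.contDiff.differentiable (by simp) (1 - x)).hasDerivAt
  have h2 := h1.scomp x ((hasDerivAt_id x).const_sub 1)
  exact h2.congr_deriv (by simp)

theorem IsHeunEigenfun.hasDerivAt_flux {c l : ℝ} {g : ℝ → ℂ} (hg : IsHeunEigenfun c l g)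
    {x : ℝ} (hx : x ∈ Icc (0 : ℝ) 2) :
    HasDerivAt (fun x : ℝ => (2 * x - x ^ 2 : ℂ) * -deriv g (1 - x))
      ((l + c ^ 2 * (1 - x) ^ 2 : ℂ) * g (1 - x)) x := by
  have h1 := ((contDiff_deriv_of_smooth hg.contDiff).differentiable (by simp) (1 - x)).hasDerivAt
  have h2 := h1.scomp x ((hasDerivAt_id x).const_sub 1)
  have h0 : HasDerivAt (fun y : ℝ => (y : ℂ)) 1 x := Complex.ofRealCLM.hasDerivAt
  have h3 := ((h0.const_mul 2).sub (h0.pow 2)).mul h2.neg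
  refine h3.congr_deriv ?_
  have h4 := hg.eq (1 - x) ⟨by linarith [hx.2], by linarith [hx.1]⟩
  rw [heunExpr] at h4
  push_cast at h4
  simp
  linear_combination h4

/-- In the variable 1 - t, uniqueness from the singular endpoint reaches every t > -1; continuity
adds t = -1. Nonzero eigenfunctions thus have g(1) ≠ 0, and eigenspaces are lines. -/
theorem IsHeunEigenfun.eqOn_zero {c l : ℝ} {g : ℝ → ℂ} (hg : IsHeunEigenfun c l g)
    (h1 : g 1 = 0) : EqOn g 0 (Icc (-1) 1) := by
  have h : EqOn g 0 (Ioo (-1) 1) := by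
    intro y hy
    have hd := (contDiff_deriv_of_smooth hg.contDiff).continuous
    have := eq_zero_of_spheroidal (b := 1 - y) (by linarith [hy.1])
      (w := fun x => g (1 - x)) (w' := fun x => -deriv g (1 - x))
      (r := fun x => (l + c ^ 2 * (1 - x) ^ 2 : ℂ)) (by fun_prop)
      (fun x _ => hg.hasDerivAt_comp_one_sub x)
      (fun x hx => hg.hasDerivAt_flux ⟨hx.1, by linarith [hx.2, hy.1]⟩)
      (Continuous.continuousOn (by fun_prop)) (by simpa using h1)
      (1 - y) ⟨by linarith [hy.2], le_rfl⟩
    simpa using this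
  have h2 := h.closure hg.contDiff.continuous continuous_zero
  rwa [closure_Ioo (by norm_num)] at h2

theorem IsHeunEigenfun.eqOn_of_eigenfun {c l : ℝ} {g h : ℝ → ℂ} (hg : IsHeunEigenfun c l g)
    (hh : IsHeunEigenfun c l h) (h1 : g 1 ≠ 0) :
    EqOn h ((h 1 / g 1) • g) (Icc (-1) 1) := by
  intro x hx
  have := (hh.add (hg.smul (-(h 1 / g 1)))).eqOn_zero
    (by simp only [Pi.add_apply, Pi.smul_apply, smul_eq_mul]; field_simp; ring) hx
  simp only [Pi.add_apply, Pi.smul_apply, smul_eq_mul, Pi.zero_apply] at this ⊢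
  linear_combination this

/-- Both sides solve the same equation regularly at x = 0 with the same value there, so uniqueness
applies to the difference. -/
theorem IsHeunEigenfun.eq_heunSol {c l : ℝ} {g : ℝ → ℂ} (hg : IsHeunEigenfun c l g)
    {x : ℝ} (hx : x ∈ Icc (0 : ℝ) 1) : g (1 - x) = g 1 * heunSol c l x := by
  have hab : ∀ y ∈ Icc (0 : ℝ) 1, |y| < 5 / 4 := fun y hy => by
    rw [abs_of_nonneg hy.1]; linarith [hy.2]
  have hd := (contDiff_deriv_of_smooth hg.contDiff).continuous
  have := eq_zero_of_spheroidal (b := 1) (by norm_num)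
      (w := fun x => g (1 - x) - g 1 * heunSol c l x)
      (w' := fun x => -deriv g (1 - x) - g 1 * heunSolDeriv c l x)
      (r := fun x => (l + c ^ 2 * (1 - x) ^ 2 : ℂ)) (by fun_prop)
      (fun x hx => (hg.hasDerivAt_comp_one_sub x).sub
        ((hasDerivAt_heunSol c l (hab x hx)).ofReal_comp.const_mul (g 1)))
      (fun x hx => ?_) ?_ (by simp [heunSol_zero]) x hx
  · linear_combination this
  · obtain ⟨v, hv, hode⟩ := exists_hasDerivAt_heunSolDeriv c l (hab x hx)
    have h0 : HasDerivAt (fun y : ℝ => (y : ℂ)) 1 x := Complex.ofRealCLM.hasDerivAt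
    have h3 := (((h0.const_mul 2).sub (h0.pow 2)).mul hv.ofReal_comp).const_mul (g 1)
    have h4 := (hg.hasDerivAt_flux ⟨hx.1, by linarith [hx.2]⟩).sub h3
    have hode' : ((2 * x - x ^ 2 : ℝ) : ℂ) * v + ((2 - 2 * x : ℝ) : ℂ) * heunSolDeriv c l x
        = ((l + c ^ 2 * (1 - x) ^ 2 : ℝ) : ℂ) * heunSol c l x := by exact_mod_cast hode
    push_cast at hode'
    refine (h4.congr_of_eventuallyEq (Eventually.of_forall fun y => ?_)).congr_deriv ?_
    · simp
      ring
    · simp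
      linear_combination -(g 1) * hode'
  · refine ContinuousOn.sub (Continuous.continuousOn (by fun_prop)) fun y hy => ?_
    obtain ⟨v, hv, -⟩ := exists_hasDerivAt_heunSolDeriv c l (hab y hy)
    exact (hv.ofReal_comp.const_mul (g 1)).continuousAt.continuousWithinAt

theorem isHeunEigenfun_smoothRep {c l : ℝ} {f : smoothI} (hf : heunT c f = (l : ℂ) • f) :
    IsHeunEigenfun c l (smoothRep f) := by
  have hg := smoothRep_contDiff f
  refine ⟨hg, ?_⟩
  have h1 := heunT_ae c f hg (smoothRep_ae f)
  rw [hf] at h1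
  have h2 : heunExpr c (smoothRep f) =ᵐ[muI] (l : ℂ) • smoothRep f :=
    h1.symm.trans ((Lp.coeFn_smul (l : ℂ) (f : L2I)).trans ((smoothRep_ae f).const_smul (l : ℂ)))
  exact continuous_eqOn_of_ae_muI (contDiff_heunExpr c hg).continuous
    (hg.continuous.const_smul (l : ℂ)) h2

theorem smoothRep_one_ne_zero {c l : ℝ} {f : smoothI} (hf : heunT c f = (l : ℂ) • f)
    (hf0 : f ≠ 0) : smoothRep f 1 ≠ 0 := by
  intro h
  apply hf0
  apply Subtype.ext
  refine Lp.eq_zero_iff_ae_eq_zero.2 ((smoothRep_ae f).trans ?_)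
  exact (ae_restrict_iff' measurableSet_Icc).2
    (Eventually.of_forall ((isHeunEigenfun_smoothRep hf).eqOn_zero h))

/-- The form in which operators commuting with T become scalars on eigenvectors: the scalar is read
off at the endpoint 1. -/
theorem eq_smul_of_ae_eigenfun {c l : ℝ} {f : smoothI} (hf : heunT c f = (l : ℂ) • f)
    (hf0 : f ≠ 0) {F : L2I} {h : ℝ → ℂ} (hh : IsHeunEigenfun c l h) (hF : F =ᵐ[muI] h) :
    F = (h 1 / smoothRep f 1) • (f : L2I) := by
  apply Lp.ext
  refine hF.trans ?_
  have h1 := (isHeunEigenfun_smoothRep hf).eqOn_of_eigenfun hh (smoothRep_one_ne_zero hf hf0)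
  have h2 : h =ᵐ[muI] (h 1 / smoothRep f 1) • smoothRep f :=
    (ae_restrict_iff' measurableSet_Icc).2 (Eventually.of_forall h1)
  exact h2.trans (((smoothRep_ae f).symm.const_smul _).trans (Lp.coeFn_smul _ _).symm)

theorem exists_eq_smul_of_eigenvector {c l : ℝ} {f g : smoothI} (hf : heunT c f = (l : ℂ) • f)
    (hf0 : f ≠ 0) (hg : heunT c g = (l : ℂ) • g) : ∃ z : ℂ, (g : L2I) = z • (f : L2I) :=
  ⟨_, eq_smul_of_ae_eigenfun hf hf0 (isHeunEigenfun_smoothRep hg) (smoothRep_ae g)⟩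

theorem reflI_ae (f : L2I) : reflI f =ᵐ[muI] fun x => f (-x) :=
  Lp.coeFn_compMeasurePreserving f measurePreserving_neg_muI

theorem reflI_eigenvector {c l : ℝ} {f : smoothI} (hf : heunT c f = (l : ℂ) • f) (hf0 : f ≠ 0) :
    reflI (f : L2I) = (smoothRep f (-1) / smoothRep f 1) • (f : L2I) := by
  refine eq_smul_of_ae_eigenfun hf hf0 (isHeunEigenfun_smoothRep hf).comp_neg ?_
  exact (reflI_ae _).trans (measurePreserving_neg_muI.quasiMeasurePreserving.ae (smoothRep_ae f))

theorem mul_I_sq (c : ℝ) : ((c : ℂ) * Complex.I) ^ 2 = -(c : ℂ) ^ 2 := by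
  rw [mul_pow, Complex.I_sq]
  ring

theorem neg_mul_I_sq (c : ℝ) : (-((c : ℂ) * Complex.I)) ^ 2 = -(c : ℂ) ^ 2 := by
  rw [neg_sq, mul_I_sq]

theorem sincOp_eigenvector {c : ℝ} (hc : 0 < c) {l : ℝ} {f : smoothI}
    (hf : heunT c f = (l : ℂ) • f) (hf0 : f ≠ 0) :
    sincOp c (f : L2I) = ((∫ t, (sincKernel c 1 t : ℂ) * smoothRep f t ∂muI) / smoothRep f 1)
      • (f : L2I) := by
  have hg := isHeunEigenfun_smoothRep hf
  have hpi : ((2 * Real.pi / c : ℝ) : ℂ) ≠ 0 := by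
    have : 2 * Real.pi / c ≠ 0 := by have := Real.pi_pos; positivity
    exact_mod_cast this
  have e : (fun x => ∫ t, (sincKernel c x t : ℂ) * smoothRep f t ∂muI)
      = ((2 * Real.pi / c : ℝ) : ℂ)⁻¹ •
        expInt (-(c * Complex.I)) (expInt (c * Complex.I) (smoothRep f)) := by
    funext x
    rw [Pi.smul_apply, expInt_expInt_eq_integral_sincKernel hc
      (integrable_muI_of_continuous hg.contDiff.continuous), smul_eq_mul, inv_mul_cancel_left₀ hpi]
  refine eq_smul_of_ae_eigenfun (h := fun x => ∫ t, (sincKernel c x t : ℂ) * smoothRep f t ∂muI)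
    hf hf0 ?_ ?_
  · rw [e]
    exact ((hg.expInt (mul_I_sq c)).expInt (neg_mul_I_sq c)).smul _
  · refine (sincOp_ae c f).trans (Eventually.of_forall fun x => ?_)
    exact integral_congr_ae ((smoothRep_ae f).mono fun t ht => by simp only [ht])

theorem integrable_sincKernel_mul (c x : ℝ) {g : ℝ → ℂ} (hg : Integrable g muI) :
    Integrable (fun t => (sincKernel c x t : ℂ) * g t) muI := by
  refine hg.bdd_mul (c := |c| / Real.pi) ?_ (Eventually.of_forall fun t => ?_)
  · exact (Complex.measurable_ofReal.comp
      ((measurable_sincKernel c).comp measurable_prodMk_left)).aestronglyMeasurable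
  · rw [Complex.norm_real]
    exact abs_sincKernel_le c x t

/-- Cut at t = 0 and put t = 1 - x on the right half, t = x - 1 on the left, so that 1 - t is x or 2
- x. The values at x - 1 are those of the reflected eigenfunction at 1 - x, hence differ by the
factor f(-1)/f(1). -/
theorem integral_sincKernel_mul_smoothRep {c l : ℝ} {f : smoothI}
    (hf : heunT c f = (l : ℂ) • f) (hf0 : f ≠ 0) :
    (∫ t, (sincKernel c 1 t : ℂ) * smoothRep f t ∂muI) / smoothRep f 1
      = ∫ x in (0 : ℝ)..1, ((Real.sin (c * x) / (Real.pi * x) : ℝ) +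
          (Real.sin (c * (2 - x)) / (Real.pi * (2 - x)) : ℝ) * (smoothRep f (-1) / smoothRep f 1))
          * (heunSol c l x : ℂ) := by
  have hg := isHeunEigenfun_smoothRep hf
  have h1 := smoothRep_one_ne_zero hf hf0
  set g := smoothRep f with hgdef
  have hint : IntervalIntegrable (fun t => (sincKernel c 1 t : ℂ) * g t) volume (-1) 1 := by
    rw [intervalIntegrable_iff_integrableOn_Icc_of_le (by norm_num)]
    exact integrable_sincKernel_mul c 1 (integrable_muI_of_continuous hg.contDiff.continuous)
  have i0 : IntervalIntegrable (fun t => (sincKernel c 1 t : ℂ) * g t) volume (-1) 0 :=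
    hint.mono_set (by
      rw [uIcc_of_le (by norm_num), uIcc_of_le (by norm_num)]
      exact Icc_subset_Icc_right (by norm_num))
  have i1 : IntervalIntegrable (fun t => (sincKernel c 1 t : ℂ) * g t) volume 0 1 :=
    hint.mono_set (by
      rw [uIcc_of_le (by norm_num), uIcc_of_le (by norm_num)]
      exact Icc_subset_Icc_left (by norm_num))
  have j0 := i0.comp_sub_right 1
  have j1 := (i1.comp_sub_left 1).symm
  norm_num at j0 j1
  rw [integral_muI_eq, ← intervalIntegral.integral_add_adjacent_intervals i0 i1]
  have e0 : ∫ t in (-1 : ℝ)..0, (sincKernel c 1 t : ℂ) * g t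
      = ∫ x in (0 : ℝ)..1, (sincKernel c 1 (x - 1) : ℂ) * g (x - 1) := by
    rw [intervalIntegral.integral_comp_sub_right (fun t => (sincKernel c 1 t : ℂ) * g t) 1]
    norm_num
  have e1 : ∫ t in (0 : ℝ)..1, (sincKernel c 1 t : ℂ) * g t
      = ∫ x in (0 : ℝ)..1, (sincKernel c 1 (1 - x) : ℂ) * g (1 - x) := by
    rw [intervalIntegral.integral_comp_sub_left (fun t => (sincKernel c 1 t : ℂ) * g t) 1]
    norm_num
  rw [e0, e1, ← intervalIntegral.integral_add j0 j1, ← intervalIntegral.integral_div]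
  refine intervalIntegral.integral_congr fun x hx => ?_
  rw [uIcc_of_le zero_le_one] at hx
  have k1 : sincKernel c 1 (1 - x) = Real.sin (c * x) / (Real.pi * x) := by
    rw [sincKernel, sub_sub_cancel]
  have k2 : sincKernel c 1 (x - 1) = Real.sin (c * (2 - x)) / (Real.pi * (2 - x)) := by
    rw [sincKernel, show 1 - (x - 1) = 2 - x by ring]
  have g1 := hg.eq_heunSol hx
  have g2 := hg.eqOn_of_eigenfun hg.comp_neg h1 (x := 1 - x)
    ⟨by linarith [hx.2], by linarith [hx.1]⟩
  simp only [neg_sub, Pi.smul_apply, smul_eq_mul] at g2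
  rw [k1, k2, g2, g1]
  field_simp
  ring

/-! ### Completeness of the eigenfunctions -/

/-- The finite-dimensional spectral theorem on W; the ambient space need not be complete, as
`smoothI` is not. -/
theorem LinearMap.IsSymmetric.mem_span_eigenvectors {E : Type*} [NormedAddCommGroup E]
    [InnerProductSpace ℂ E] {T : E →ₗ[ℂ] E} (hT : T.IsSymmetric) (W : Submodule ℂ E)
    [FiniteDimensional ℂ W] (hinv : ∀ w ∈ W, T w ∈ W) {w : E} (hw : w ∈ W) :
    w ∈ Submodule.span ℂ {v | ∃ l : ℝ, T v = (l : ℂ) • v} := by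
  have hsymm := hT.restrict_invariant hinv
  have htop : (⨆ l, Module.End.eigenspace (T.restrict hinv) l) = ⊤ := by
    rw [← Submodule.orthogonal_eq_bot_iff]
    exact hsymm.orthogonalComplement_iSup_eigenspaces_eq_bot
  have hmem : (⟨w, hw⟩ : W) ∈ (⨆ l, Module.End.eigenspace (T.restrict hinv) l) := by
    rw [htop]; exact Submodule.mem_top
  refine Submodule.iSup_induction _
    (motive := fun w : W => (w : E) ∈ Submodule.span ℂ {v | ∃ l : ℝ, T v = (l : ℂ) • v})
    hmem ?_ (Submodule.zero_mem _) (fun a b ha hb => Submodule.add_mem _ ha hb)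
  intro l v hv
  by_cases hv0 : v = 0
  · rw [hv0]; exact Submodule.zero_mem _
  have hreal := hsymm.conj_eigenvalue_eq_self
    (Module.End.hasEigenvalue_of_hasEigenvector ⟨hv, hv0⟩)
  have hv' := congrArg (fun w : W => (w : E)) (Module.End.mem_eigenspace_iff.1 hv)
  refine Submodule.subset_span ⟨l.re, ?_⟩
  rw [Complex.conj_eq_iff_re.1 hreal]
  exact hv'

/-- The span of the smooth eigenfunctions of the Heun operator. -/
def heunEigenSpan (c : ℝ) : Submodule ℂ L2I :=
  Submodule.span ℂ {x | ∃ f : smoothI, ∃ l : ℝ, heunT c f = (l : ℂ) • f ∧ x = f}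

/-- The square of the finite Fourier transform. -/
def bandOp (c : ℝ) : L2I →L[ℂ] L2I :=
  expOp (-(c * Complex.I)) ∘L expOp (c * Complex.I)

theorem bandOp_eq_adjoint_comp (c : ℝ) :
    bandOp c = ContinuousLinearMap.adjoint (expOp (c * Complex.I)) ∘L expOp (c * Complex.I) := by
  rw [bandOp, adjoint_expOp]
  congr 2
  simp

theorem isCompactOperator_bandOp (c : ℝ) : IsCompactOperator (bandOp c) :=
  (isCompactOperator_expOp _).comp_clm (expOp (c * Complex.I))

theorem bandOp_isSymmetric (c : ℝ) : (bandOp c : L2I →ₗ[ℂ] L2I).IsSymmetric := by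
  intro f g
  change inner ℂ (bandOp c f) g = inner ℂ f (bandOp c g)
  rw [bandOp_eq_adjoint_comp, ContinuousLinearMap.comp_apply, ContinuousLinearMap.comp_apply,
    ContinuousLinearMap.adjoint_inner_left, ContinuousLinearMap.adjoint_inner_right]

theorem bandOp_injective {c : ℝ} (hc : c ≠ 0) {f : L2I} (hf : bandOp c f = 0) : f = 0 := by
  have h : (c : ℂ) * Complex.I ≠ 0 := mul_ne_zero (by exact_mod_cast hc) Complex.I_ne_zero
  exact expOp_injective h (expOp_injective (neg_ne_zero.2 h) hf)

theorem bandOp_mem_smoothI (c : ℝ) (f : L2I) : bandOp c f ∈ smoothI := expOp_mem_smoothI _ _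

theorem heunT_bandOp (c : ℝ) (f : smoothI) :
    (heunT c ⟨bandOp c f, bandOp_mem_smoothI c f⟩ : L2I) = bandOp c (heunT c f : L2I) := by
  have h1 := heunT_expOp (neg_mul_I_sq c) ⟨expOp (c * Complex.I) f, expOp_mem_smoothI _ _⟩
  rw [heunT_expOp (mul_I_sq c) f] at h1
  exact h1

/-- For μ ≠ 0 the eigenspace is finite-dimensional by compactness, smooth because v = μ⁻¹ `bandOp c
v`, and T-invariant by commutation, so T is diagonalizable on it. Injectivity disposes of μ = 0. -/
theorem eigenspace_bandOp_le {c : ℝ} (hc : c ≠ 0) (μ : ℂ) :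
    Module.End.eigenspace (bandOp c : Module.End ℂ L2I) μ ≤ heunEigenSpan c := by
  intro f hf
  have hf' : bandOp c f = μ • f := Module.End.mem_eigenspace_iff.1 hf
  by_cases hμ : μ = 0
  · rw [hμ, zero_smul] at hf'
    rw [bandOp_injective hc hf']
    exact Submodule.zero_mem _
  set V := Module.End.eigenspace (bandOp c : Module.End ℂ L2I) μ with hV
  have hfin : FiniteDimensional ℂ V :=
    ContinuousLinearMap.finite_dimensional_eigenspace (isCompactOperator_bandOp c) μ hμ
  have hVs : ∀ v ∈ V, v ∈ smoothI := by
    intro v hv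
    have h1 : bandOp c v = μ • v := Module.End.mem_eigenspace_iff.1 hv
    rw [← inv_smul_smul₀ hμ v, ← h1]
    exact smoothI.smul_mem _ (bandOp_mem_smoothI c v)
  set W : Submodule ℂ smoothI := V.comap smoothI.subtype with hW
  have hWfin : FiniteDimensional ℂ W := by
    refine FiniteDimensional.of_injective
      ((smoothI.subtype.comp W.subtype).codRestrict V fun w => w.2) ?_
    intro a b hab
    exact Subtype.ext (Subtype.ext (congrArg (fun v : V => (v : L2I)) hab))
  have hinv : ∀ w ∈ W, heunT c w ∈ W := by
    intro w hw
    have h1 : bandOp c (w : L2I) = μ • (w : L2I) := Module.End.mem_eigenspace_iff.1 hw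
    refine Module.End.mem_eigenspace_iff.2 ?_
    change bandOp c (heunT c w : L2I) = μ • (heunT c w : L2I)
    rw [← heunT_bandOp]
    have h2 : (⟨bandOp c w, bandOp_mem_smoothI c w⟩ : smoothI) = μ • w := Subtype.ext h1
    rw [h2, map_smul]
    rfl
  have h := (heunT_isSymmetric c).mem_span_eigenvectors W hinv (w := ⟨f, hVs f hf⟩) hf
  have h2 := Submodule.mem_map_of_mem (f := smoothI.subtype) h
  rw [Submodule.map_span] at h2
  refine Submodule.span_mono ?_ h2
  rintro _ ⟨v, ⟨l, hl⟩, rfl⟩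
  exact ⟨v, l, hl, rfl⟩

theorem heunEigenSpan_topologicalClosure {c : ℝ} (hc : c ≠ 0) :
    (heunEigenSpan c).topologicalClosure = ⊤ := by
  rw [Submodule.topologicalClosure_eq_top_iff, eq_bot_iff,
    ← ContinuousLinearMap.orthogonalComplement_iSup_eigenspaces_eq_bot
      (isCompactOperator_bandOp c) (bandOp_isSymmetric c)]
  exact Submodule.orthogonal_le (iSup_le fun μ => eigenspace_bandOp_le hc μ)

/-- Needed because the uniform bound on `heunSol` is available for l ≤ 0 only. -/
theorem eigenvalue_nonpos {c l : ℝ} {f : smoothI} (hf : heunT c f = (l : ℂ) • f) (hf0 : f ≠ 0) :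
    l ≤ 0 := by
  have h := re_inner_heunT_nonpos c f
  rw [hf, Submodule.coe_smul, inner_smul_right, inner_self_eq_norm_sq_to_K] at h
  have h1 : 0 < ‖(f : L2I)‖ := norm_pos_iff.2 fun h => hf0 (Subtype.ext h)
  have h2 : l * ‖(f : L2I)‖ ^ 2 ≤ 0 := by
    have e : (l : ℂ) * ((‖(f : L2I)‖ : ℝ) : ℂ) ^ 2 = ((l * ‖(f : L2I)‖ ^ 2 : ℝ) : ℂ) := by
      push_cast; ring
    have h3 : ((l : ℂ) * ((‖(f : L2I)‖ : ℝ) : ℂ) ^ 2).re ≤ 0 := h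
    rwa [e, Complex.ofReal_re] at h3
  nlinarith [pow_pos h1 2]

/-! ### Diagonal operators and closures -/

theorem HilbertBasis.exists_diagonal {ι H : Type*} [NormedAddCommGroup H] [InnerProductSpace ℂ H]
    (b : HilbertBasis ι ℂ H) (m : ι → ℂ) {M : ℝ} (hM0 : 0 ≤ M)
    (hM : ∀ i, ‖m i‖ ≤ M) :
    ∃ D : H →L[ℂ] H, (∀ f, ‖D f‖ ≤ M * ‖f‖) ∧ ∀ i f, inner ℂ (b i) (D f) = m i * inner ℂ (b i) f := by
  have hle : ∀ (f : lp (fun _ : ι => ℂ) 2) (i : ι), ‖m i * f i‖ ≤ ‖((M : ℂ) • f) i‖ := by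
    intro f i
    rw [lp.coeFn_smul, Pi.smul_apply, norm_smul, norm_mul, Complex.norm_real,
      Real.norm_of_nonneg hM0]
    exact mul_le_mul_of_nonneg_right (hM i) (norm_nonneg _)
  have hmem : ∀ f : lp (fun _ : ι => ℂ) 2, Memℓp (fun i => m i * f i) 2 := fun f =>
    (lp.memℓp ((M : ℂ) • f)).mono' (hle f)
  let L : lp (fun _ : ι => ℂ) 2 →ₗ[ℂ] lp (fun _ : ι => ℂ) 2 :=
    { toFun := fun f => ⟨fun i => m i * f i, hmem f⟩
      map_add' := fun f g => by
        ext i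
        exact mul_add _ _ _
      map_smul' := fun z f => by
        ext i
        exact mul_left_comm _ _ _ }
  have hL : ∀ f, ‖L f‖ ≤ M * ‖f‖ := by
    intro f
    refine (lp.norm_mono (y := (M : ℂ) • f) two_ne_zero (hle f)).trans (le_of_eq ?_)
    rw [norm_smul, Complex.norm_real, Real.norm_of_nonneg hM0]
  let D : H →ₗ[ℂ] H := b.repr.symm.toLinearEquiv.toLinearMap ∘ₗ L ∘ₗ b.repr.toLinearEquiv.toLinearMap
  have hD : ∀ f, D f = b.repr.symm (L (b.repr f)) := fun _ => rfl
  have hDn : ∀ f, ‖D f‖ ≤ M * ‖f‖ := by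
    intro f
    rw [hD, LinearIsometryEquiv.norm_map]
    exact (hL _).trans_eq (by rw [LinearIsometryEquiv.norm_map])
  refine ⟨D.mkContinuous M hDn, hDn, fun i f => ?_⟩
  rw [LinearMap.mkContinuous_apply, hD, ← b.repr_apply_apply, ← b.repr_apply_apply,
    LinearIsometryEquiv.apply_symm_apply]
  rfl

theorem HilbertBasis.ext_inner {ι H : Type*} [NormedAddCommGroup H] [InnerProductSpace ℂ H]
    (b : HilbertBasis ι ℂ H) {f g : H} (h : ∀ i, inner ℂ (b i) f = inner ℂ (b i) g) : f = g := by
  apply b.repr.injective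
  ext i
  rw [b.repr_apply_apply, b.repr_apply_apply, h]

/-- The graph of U is closed and contains that of A; conversely x ↦ (x, Ux) is continuous, so
density of the domain makes the graph of A dense in it. -/
theorem LinearPMap.closure_eq_of_eq_clm {H : Type*} [NormedAddCommGroup H] [NormedSpace ℂ H]
    (A : H →ₗ.[ℂ] H) (hA : Dense (A.domain : Set H)) (U : H →L[ℂ] H)
    (h : ∀ x : A.domain, A x = U x) :
    A.IsClosable ∧ A.closure = (U : H →ₗ[ℂ] H).toPMap ⊤ := by
  have hmem : ∀ p : H × H, p ∈ ((U : H →ₗ[ℂ] H).toPMap ⊤).graph ↔ U p.1 = p.2 := by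
    intro p
    rw [LinearPMap.mem_graph_iff]
    constructor
    · rintro ⟨y, h1, h2⟩
      rw [← h1, ← h2]
      rfl
    · intro hp
      exact ⟨⟨p.1, Submodule.mem_top⟩, rfl, hp⟩
  have key : A.graph.topologicalClosure = ((U : H →ₗ[ℂ] H).toPMap ⊤).graph := by
    apply le_antisymm
    · refine Submodule.topologicalClosure_minimal _ ?_ ?_
      · intro p hp
        obtain ⟨y, h1, h2⟩ := A.mem_graph_iff.1 hp
        rw [hmem, ← h1, ← h2, h]
      · have : (((U : H →ₗ[ℂ] H).toPMap ⊤).graph : Set (H × H)) = {p | U p.1 = p.2} :=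
          Set.ext hmem
        rw [this]
        exact isClosed_eq (U.continuous.comp continuous_fst) continuous_snd
    · intro p hp
      have hp2 : p = (p.1, U p.1) := Prod.ext rfl ((hmem p).1 hp).symm
      have hc : Continuous fun x : H => (x, U x) := continuous_id.prodMk U.continuous
      have h1 := map_mem_closure hc (hA p.1) (t := (A.graph : Set (H × H))) (fun x hx => by
        have := A.mem_graph ⟨x, hx⟩
        rwa [h] at this)
      rw [← hp2] at h1
      exact h1
  have hcl : A.IsClosable := ⟨_, key⟩
  exact ⟨hcl, LinearPMap.eq_of_eq_graph (hcl.graph_closure_eq_closure_graph.symm.trans key)⟩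

/-! ### The partial sums on eigenvectors -/

/-- Symmetry moves each T onto v. This gives the coefficients of p(T)f for every f, not only for
combinations of eigenvectors, and so controls the series on its whole domain. -/
theorem LinearMap.IsSymmetric.inner_aeval_eigenvector {E : Type*} [NormedAddCommGroup E]
    [InnerProductSpace ℂ E] {T : E →ₗ[ℂ] E} (hT : T.IsSymmetric) {l : ℝ} {v : E}
    (hv : T v = (l : ℂ) • v) (p : Polynomial ℂ) (f : E) :
    inner ℂ v (Polynomial.aeval T p f) = p.eval (l : ℂ) * inner ℂ v f := by
  induction p using Polynomial.induction_on with
  | C a => simp [Module.algebraMap_end_apply]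
  | add p q hp hq => simp [hp, hq, add_mul]
  | monomial n a h =>
    have e : Polynomial.aeval T (Polynomial.C a * Polynomial.X ^ (n + 1)) f
        = T (Polynomial.aeval T (Polynomial.C a * Polynomial.X ^ n) f) := by
      rw [pow_succ', ← mul_assoc, mul_comm (Polynomial.C a) Polynomial.X, mul_assoc, map_mul,
        Polynomial.aeval_X]
      rfl
    rw [e, ← hT, hv, inner_smul_left, h, Complex.conj_ofReal]
    simp only [Polynomial.eval_mul, Polynomial.eval_C, Polynomial.eval_pow, Polynomial.eval_X]
    ring

theorem tendsto_sum_heunPoly (c l : ℝ) {ξ : ℝ} (hξ : ξ ∈ Icc (0 : ℝ) 1) :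
    Tendsto (fun n => ∑ k ∈ Finset.range n,
      ((ξ : ℂ) ^ k / (k.factorial : ℂ)) * (heunPoly c k).eval (l : ℂ)) atTop
      (𝓝 (heunSol c l ξ : ℂ)) := by
  have hx : |ξ| ≤ 5 / 4 := by rw [abs_of_nonneg hξ.1]; linarith [hξ.2]
  have h := (((geomBounded_heunCoeff c l).summable hx).hasSum.tendsto_sum_nat)
  have h2 := (Complex.continuous_ofReal.tendsto _).comp h
  refine h2.congr fun n => ?_
  simp only [Function.comp_apply, Complex.ofReal_sum]
  refine Finset.sum_congr rfl fun k _ => ?_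
  push_cast
  rw [← heunPoly_eval_div_factorial]
  ring

theorem heunPartialSum_eigenvector {c l : ℝ} {v : smoothI} (hv : heunT c v = (l : ℂ) • v)
    (ξ : ℝ) (n : ℕ) : heunPartialSum c ξ n v = (∑ k ∈ Finset.range n,
      ((ξ : ℂ) ^ k / (k.factorial : ℂ)) * (heunPoly c k).eval (l : ℂ)) • v := by
  rw [heunPartialSum, LinearMap.sum_apply, Finset.sum_smul]
  refine Finset.sum_congr rfl fun k _ => ?_
  rw [LinearMap.smul_apply, Module.End.aeval_apply_of_mem_apply_eq_smul hv, smul_smul]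

theorem inner_heunPartialSum {c l : ℝ} {v : smoothI} (hv : heunT c v = (l : ℂ) • v)
    (ξ : ℝ) (n : ℕ) (f : smoothI) :
    inner ℂ (v : L2I) (heunPartialSum c ξ n f : L2I) = (∑ k ∈ Finset.range n,
      ((ξ : ℂ) ^ k / (k.factorial : ℂ)) * (heunPoly c k).eval (l : ℂ))
        * inner ℂ (v : L2I) (f : L2I) := by
  change inner ℂ v (heunPartialSum c ξ n f) = _ * inner ℂ v f
  rw [heunPartialSum, LinearMap.sum_apply, inner_sum, Finset.sum_mul]
  refine Finset.sum_congr rfl fun k _ => ?_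
  rw [LinearMap.smul_apply, inner_smul_right, (heunT_isSymmetric c).inner_aeval_eigenvector hv,
    mul_assoc]

theorem mem_heunSeries_domain {c l : ℝ} {v : smoothI} (hv : heunT c v = (l : ℂ) • v)
    {ξ : ℝ} (hξ : ξ ∈ Icc (0 : ℝ) 1) : (v : L2I) ∈ (heunSeries c ξ).domain := by
  refine ⟨v, ⟨(heunSol c l ξ : ℂ) • (v : L2I), ?_⟩, rfl⟩
  refine ((tendsto_sum_heunPoly c l hξ).smul_const (v : L2I)).congr fun n => ?_
  rw [heunPartialSum_eigenvector hv]
  rfl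

theorem dense_heunEigenSpan {c : ℝ} (hc : c ≠ 0) : Dense (heunEigenSpan c : Set L2I) :=
  Submodule.dense_iff_topologicalClosure_eq_top.2 (heunEigenSpan_topologicalClosure hc)

theorem dense_heunSeries_domain {c : ℝ} (hc : c ≠ 0) {ξ : ℝ} (hξ : ξ ∈ Icc (0 : ℝ) 1) :
    Dense ((heunSeries c ξ).domain : Set L2I) := by
  refine (dense_heunEigenSpan hc).mono ?_
  refine Submodule.span_le.2 ?_
  rintro _ ⟨f, l, hf, rfl⟩
  exact mem_heunSeries_domain hf hξ

/-! ### The Hilbert basis of eigenfunctions -/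

/-- The eigenvalues of the Heun operator on smooth functions. -/
abbrev HeunEigenvalue (c : ℝ) : Type :=
  {l : ℝ // ∃ f : smoothI, f ≠ 0 ∧ heunT c f = (l : ℂ) • f}

/-- The eigenvalues themselves can index the basis because eigenspaces are one-dimensional. -/
theorem exists_heun_hilbertBasis {c : ℝ} (hc : c ≠ 0) :
    ∃ (b : HilbertBasis (HeunEigenvalue c) ℂ L2I) (v : HeunEigenvalue c → smoothI),
      ∀ i, b i = v i ∧ v i ≠ 0 ∧ heunT c (v i) = (i.1 : ℂ) • v i := by
  choose f hf0 hf using fun i : HeunEigenvalue c => i.2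
  have hn : ∀ i, ‖(f i : L2I)‖ ≠ 0 := fun i => norm_ne_zero_iff.2 fun h => hf0 i (Subtype.ext h)
  obtain ⟨v, hvdef⟩ : ∃ v : HeunEigenvalue c → smoothI,
      v = fun i => (((‖(f i : L2I)‖⁻¹ : ℝ)) : ℂ) • f i := ⟨_, rfl⟩
  have hz : ∀ i, (((‖(f i : L2I)‖⁻¹ : ℝ)) : ℂ) ≠ 0 := fun i => by
    exact_mod_cast inv_ne_zero (hn i)
  have hv : ∀ i, heunT c (v i) = (i.1 : ℂ) • v i := by
    intro i
    rw [hvdef]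
    simp only [map_smul, hf i]
    rw [smul_comm]
  have hv0 : ∀ i, v i ≠ 0 := fun i => by
    rw [hvdef]
    exact smul_ne_zero (hz i) (hf0 i)
  have horth : Orthonormal ℂ fun i => (v i : L2I) := by
    constructor
    · intro i
      rw [hvdef]
      change ‖(((‖(f i : L2I)‖⁻¹ : ℝ)) : ℂ) • (f i : L2I)‖ = 1
      rw [norm_smul, Complex.norm_real, norm_inv, norm_norm, inv_mul_cancel₀ (hn i)]
    · intro i j hij
      have h1 : inner ℂ (heunT c (v i) : L2I) (v j : L2I)
          = inner ℂ (v i : L2I) (heunT c (v j) : L2I) := heunT_isSymmetric c (v i) (v j)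
      rw [hv, hv, Submodule.coe_smul, Submodule.coe_smul, inner_smul_left, inner_smul_right,
        Complex.conj_ofReal] at h1
      have h2 : ((i.1 : ℂ) - (j.1 : ℂ)) * inner ℂ (v i : L2I) (v j : L2I) = 0 := by
        rw [sub_mul, h1, sub_self]
      refine (mul_eq_zero.1 h2).resolve_left (sub_ne_zero.2 fun h => hij (Subtype.ext ?_))
      exact_mod_cast h
  have hspan : ⊤ ≤ (Submodule.span ℂ (range fun i => (v i : L2I))).topologicalClosure := by
    rw [← heunEigenSpan_topologicalClosure hc]
    refine Submodule.topologicalClosure_mono (Submodule.span_le.2 ?_)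
    rintro _ ⟨g, l, hg, rfl⟩
    by_cases hg0 : g = 0
    · rw [hg0]; exact Submodule.zero_mem _
    obtain ⟨z, hz⟩ := exists_eq_smul_of_eigenvector (hv ⟨l, g, hg0, hg⟩) (hv0 _) hg
    rw [hz]
    exact Submodule.smul_mem _ _ (Submodule.subset_span (mem_range_self _))
  refine ⟨HilbertBasis.mk horth hspan, v, fun i => ⟨?_, hv0 i, hv i⟩⟩
  rw [HilbertBasis.coe_mk]

/-- The bounded operators `U(ξ; T)`, determined by their values on eigenvectors. -/
theorem exists_heunU_clm {c : ℝ} (hc : c ≠ 0) :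
    ∃ (M : ℝ) (U : ℝ → (L2I →L[ℂ] L2I)), 0 ≤ M ∧ (∀ ξ f, ‖U ξ f‖ ≤ M * ‖f‖) ∧
      (∀ ξ ∈ Icc (0 : ℝ) 1, ∀ (l : ℝ) (f : smoothI), heunT c f = (l : ℂ) • f →
        U ξ f = (heunSol c l ξ : ℂ) • (f : L2I)) ∧
      ∀ ξ ∈ Icc (0 : ℝ) 1, ∀ x : (heunSeries c ξ).domain, heunSeries c ξ x = U ξ x := by
  obtain ⟨b, v, hbv⟩ := exists_heun_hilbertBasis hc
  obtain ⟨M, hM⟩ := exists_abs_heunSol_le c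
  have hM0 : 0 ≤ max M 0 := le_max_right _ _
  -- Outside [0,1] the operator is set to 0, so that the norm bound holds for every ξ.
  have hex : ∀ ξ : ℝ, ∃ D : L2I →L[ℂ] L2I, (∀ f, ‖D f‖ ≤ max M 0 * ‖f‖) ∧ (ξ ∈ Icc (0 : ℝ) 1 →
      ∀ i f, inner ℂ (b i) (D f) = (heunSol c i.1 ξ : ℂ) * inner ℂ (b i) f) := by
    intro ξ
    by_cases hξ : ξ ∈ Icc (0 : ℝ) 1
    · obtain ⟨D, h1, h2⟩ := b.exists_diagonal (fun i => (heunSol c i.1 ξ : ℂ)) hM0 fun i => by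
        rw [Complex.norm_real]
        exact (hM i.1 (eigenvalue_nonpos (hbv i).2.2 (hbv i).2.1) ξ hξ).trans (le_max_left _ _)
      exact ⟨D, h1, fun _ => h2⟩
    · exact ⟨0, fun f => by simpa using by positivity, fun h => absurd h hξ⟩
  choose U hU1 hU2 using hex
  -- Any L² limit of the partial sums has the coefficients of U(ξ)f in the basis of eigenfunctions,
  -- hence equals it.
  have hlim : ∀ ξ ∈ Icc (0 : ℝ) 1, ∀ (f : smoothI) (h : L2I),
      Tendsto (fun n => ((heunPartialSum c ξ n f : smoothI) : L2I)) atTop (𝓝 h) → h = U ξ f := by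
    intro ξ hξ f h hh
    refine b.ext_inner fun i => ?_
    rw [hU2 ξ hξ i, (hbv i).1]
    have h1 : Tendsto (fun n => inner ℂ (v i : L2I) (heunPartialSum c ξ n f : L2I)) atTop
        (𝓝 (inner ℂ (v i : L2I) h)) :=
      ((continuous_const.inner continuous_id).tendsto h).comp hh
    refine tendsto_nhds_unique h1 ?_
    simp_rw [inner_heunPartialSum (hbv i).2.2]
    exact (tendsto_sum_heunPoly c i.1 hξ).mul_const _
  refine ⟨max M 0, U, hM0, hU1, fun ξ hξ l f hf => ?_, fun ξ hξ x => ?_⟩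
  · refine (hlim ξ hξ f _ ?_).symm
    refine ((tendsto_sum_heunPoly c l hξ).smul_const (f : L2I)).congr fun n => ?_
    rw [heunPartialSum_eigenvector hf]
    rfl
  · have hs := (heunSeriesDomain_of_mem_map x.2).choose
    exact hlim ξ hξ ⟨x, hs⟩ _ (heunSeriesValue_spec c ξ x hs)

/-! ### The integral formula -/

theorem continuousOn_heunSol (c l : ℝ) : ContinuousOn (heunSol c l) (Icc 0 1) := fun x hx =>
  (hasDerivAt_heunSol c l (by rw [abs_of_nonneg hx.1]; linarith [hx.2])).continuousAt
    |>.continuousWithinAt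

/-- Approximating f by g in the span makes U(x)f a uniform limit of continuous functions of x. The
proof divides by M + 1 because M may be 0. -/
theorem continuousOn_of_bounded_of_dense {H : Type*} [NormedAddCommGroup H] [NormedSpace ℂ H]
    {U : ℝ → (H →L[ℂ] H)} {M : ℝ} (hM0 : 0 ≤ M) (hM : ∀ x f, ‖U x f‖ ≤ M * ‖f‖) {s : Set ℝ}
    {t : Set H} (ht : Dense (Submodule.span ℂ t : Set H))
    (h : ∀ f ∈ t, ContinuousOn (fun x => U x f) s) (f : H) : ContinuousOn (fun x => U x f) s := by
  have hspan : ∀ g ∈ Submodule.span ℂ t, ContinuousOn (fun x => U x g) s := by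
    intro g hg
    induction hg using Submodule.span_induction with
    | mem g hg => exact h g hg
    | zero => simpa using continuousOn_const
    | add a b _ _ ha hb => simpa only [map_add] using ha.fun_add hb
    | smul z a _ ha => simpa only [map_smul] using ha.fun_const_smul z
  refine continuousOn_of_uniform_approx_of_continuousOn fun u hu => ?_
  obtain ⟨ε, hε, hεu⟩ := Metric.mem_uniformity_dist.1 hu
  obtain ⟨g, hg, hfg⟩ := Metric.dense_iff.1 ht f (ε / (M + 1)) (by positivity)
  refine ⟨fun x => U x g, hspan g hfg, fun y _ => hεu ?_⟩
  rw [Metric.mem_ball, dist_comm, dist_eq_norm] at hg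
  rw [dist_eq_norm, ← map_sub]
  refine (hM y _).trans_lt ?_
  calc M * ‖f - g‖ ≤ (M + 1) * ‖f - g‖ := by gcongr; linarith
    _ < (M + 1) * (ε / (M + 1)) := by gcongr
    _ = ε := by field_simp

theorem norm_reflI (f : L2I) : ‖reflI f‖ = ‖f‖ := LinearIsometry.norm_map _ f

theorem sincWeight_apply (c ξ : ℝ) (f : L2I) : sincWeight c ξ f =
    ((Real.sin (c * ξ) / (Real.pi * ξ) : ℝ) : ℂ) • f
      + ((Real.sin (c * (2 - ξ)) / (Real.pi * (2 - ξ)) : ℝ) : ℂ) • reflI f := rfl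

theorem norm_sincWeight_le (c ξ : ℝ) (f : L2I) :
    ‖sincWeight c ξ f‖ ≤ 2 * (|c| / Real.pi) * ‖f‖ := by
  -- The two scalar weights are kernel values at (ξ, 0) and (2 - ξ, 0), so the kernel bound covers ξ
  -- = 0 as well.
  have h1 := abs_sincKernel_le c ξ 0
  have h2 := abs_sincKernel_le c (2 - ξ) 0
  rw [sincKernel, sub_zero] at h1 h2
  rw [sincWeight_apply]
  refine (norm_add_le _ _).trans ?_
  rw [norm_smul, norm_smul, norm_reflI, Complex.norm_real, Complex.norm_real, Real.norm_eq_abs,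
    Real.norm_eq_abs, two_mul, add_mul]
  gcongr

/-- The point 0 is left out: sin(cξ)/(πξ) takes the value 0 there by convention rather than its
limit c/π. Being null, it does not affect the integral. -/
theorem continuousOn_sincWeight {c : ℝ} {F : ℝ → L2I} (hF : ContinuousOn F (Icc 0 1)) :
    ContinuousOn (fun ξ => sincWeight c ξ (F ξ)) (Ioc 0 1) := by
  have hF' := hF.mono Ioc_subset_Icc_self
  have h1 : ContinuousOn (fun ξ : ℝ => Real.sin (c * ξ) / (Real.pi * ξ)) (Ioc 0 1) :=
    ContinuousOn.div (by fun_prop) (by fun_prop) fun ξ hξ =>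
      mul_ne_zero Real.pi_ne_zero hξ.1.ne'
  have h2 : ContinuousOn (fun ξ : ℝ => Real.sin (c * (2 - ξ)) / (Real.pi * (2 - ξ))) (Ioc 0 1) :=
    ContinuousOn.div (by fun_prop) (by fun_prop) fun ξ hξ =>
      mul_ne_zero Real.pi_ne_zero (by linarith [hξ.2])
  simp only [sincWeight_apply]
  exact ((Complex.continuous_ofReal.comp_continuousOn h1).smul hF').add
    ((Complex.continuous_ofReal.comp_continuousOn h2).smul
      (reflI.continuous.comp_continuousOn hF'))

theorem intervalIntegrable_sincWeight {c : ℝ} {F : ℝ → L2I} (hF : ContinuousOn F (Icc 0 1)) :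
    IntervalIntegrable (fun ξ => sincWeight c ξ (F ξ)) volume 0 1 := by
  rw [intervalIntegrable_iff_integrableOn_Ioc_of_le zero_le_one]
  obtain ⟨B, hB⟩ := isCompact_Icc.exists_bound_of_continuousOn hF
  refine Integrable.of_bound
    ((continuousOn_sincWeight hF).aestronglyMeasurable measurableSet_Ioc)
    (2 * (|c| / Real.pi) * B) ?_
  refine (ae_restrict_iff' measurableSet_Ioc).2 (Eventually.of_forall fun ξ hξ => ?_)
  refine (norm_sincWeight_le c ξ _).trans ?_
  gcongr
  exact hB ξ (Ioc_subset_Icc_self hξ)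

theorem integral_sincWeight_eigenvector {c : ℝ} (hc : 0 < c) {l : ℝ} {f : smoothI}
    (hf : heunT c f = (l : ℂ) • f) {U : ℝ → (L2I →L[ℂ] L2I)}
    (hU : ∀ ξ ∈ Icc (0 : ℝ) 1, U ξ f = (heunSol c l ξ : ℂ) • (f : L2I)) :
    sincOp c (f : L2I) = ∫ ξ in (0 : ℝ)..1, sincWeight c ξ (U ξ f) := by
  by_cases hf0 : f = 0
  · subst hf0
    simp
  rw [sincOp_eigenvector hc hf hf0, integral_sincKernel_mul_smoothRep hf hf0,
    ← intervalIntegral.integral_smul_const]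
  refine intervalIntegral.integral_congr fun ξ hξ => ?_
  rw [uIcc_of_le zero_le_one] at hξ
  rw [hU ξ hξ, map_smul, sincWeight_apply, reflI_eigenvector hf hf0]
  module

end

/-! ### Extension of the formula from eigenfunctions by density -/

theorem mainTheorem5 (c : ℝ) (hc : 0 < c) :
    ∃ U : ℝ → (L2I →L[ℂ] L2I),
      (∀ ξ ∈ Set.Icc (0 : ℝ) 1,
        Dense ((heunSeries c ξ).domain : Set L2I) ∧
        (heunSeries c ξ).IsClosable ∧
        heunU c ξ = (U ξ : L2I →ₗ[ℂ] L2I).toPMap ⊤) ∧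
      ∀ f : L2I,
        IntervalIntegrable (fun ξ : ℝ => sincWeight c ξ (U ξ f)) MeasureTheory.volume 0 1 ∧
        sincOp c f = ∫ ξ in (0 : ℝ)..1, sincWeight c ξ (U ξ f) := by
  obtain ⟨M, U, hM0, hM, hUe, hUs⟩ := exists_heunU_clm hc.ne'
  have hcont : ∀ f, ContinuousOn (fun ξ => U ξ f) (Icc 0 1) := by
    refine continuousOn_of_bounded_of_dense hM0 hM (dense_heunEigenSpan hc.ne') ?_
    rintro _ ⟨f, l, hf, rfl⟩
    refine ContinuousOn.congr ?_ fun ξ hξ => hUe ξ hξ l f hf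
    exact (Complex.continuous_ofReal.comp_continuousOn (continuousOn_heunSol c l)).smul
      continuousOn_const
  have hint := fun f => intervalIntegrable_sincWeight (c := c) (hcont f)
  refine ⟨U, fun ξ hξ => ⟨dense_heunSeries_domain hc.ne' hξ,
    LinearPMap.closure_eq_of_eq_clm _ (dense_heunSeries_domain hc.ne' hξ) (U ξ) (hUs ξ hξ)⟩,
    fun f => ⟨hint f, ?_⟩⟩
  let J : L2I →L[ℂ] L2I := LinearMap.mkContinuous
    { toFun := fun f => ∫ ξ in (0 : ℝ)..1, sincWeight c ξ (U ξ f)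
      map_add' := fun f g => by
        simp only [map_add]
        exact intervalIntegral.integral_add (hint f) (hint g)
      map_smul' := fun z f => by
        simp only [map_smul]
        exact intervalIntegral.integral_smul z _ }
    (2 * (|c| / Real.pi) * M) fun f => by
      refine (intervalIntegral.norm_integral_le_of_norm_le_const
        (C := 2 * (|c| / Real.pi) * M * ‖f‖) fun ξ _ => ?_).trans (by simp)
      refine (norm_sincWeight_le c ξ _).trans ?_
      rw [mul_assoc _ M]
      gcongr
      exact hM ξ f
  -- The factorization through the finite Fourier transform supplies the continuity of `sincOp`,
  -- which is only a linear map by definition.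
  let Q : L2I →L[ℂ] L2I := ((c / (2 * Real.pi) : ℝ) : ℂ) •
    (expOp (-(c * Complex.I)) ∘L expOp (c * Complex.I))
  have hQ : ∀ f, Q f = sincOp c f := fun f => (sincOp_eq_expOp hc f).symm
  have hQJ : Q = J := by
    refine ContinuousLinearMap.ext_on (dense_heunEigenSpan hc.ne') ?_
    rintro _ ⟨f, l, hf, rfl⟩
    rw [hQ]
    exact integral_sincWeight_eigenvector hc hf fun ξ hξ => hUe ξ hξ l f hf
  rw [← hQ, hQJ]
  rfl
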